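/- **Model.** Let $\mathcal{E}$ be the finite set of lanes (arcs $(i,j)$, self-loops allowed) of a transportation network. For each lane $(i,j)\in\mathcal{E}$ the following are given. * A set of admissible shipper prices and on it a strictly decreasing demand function $d_{ij}(\cdot)\ge 0$, with inverse $r_{ij}(\cdot)$ defined on the set $\mathcal{D}_{ij}$ of attainable demand rates; $\mathcal{D}_{ij}$ is an interval and $d\mapsto r_{ij}(d)\,d$ is concave on it. * A unit penalty $b_{ij}\in\mathbb{R}$, a carrier arrival rate $\lambda_{ij}>0$, and a staying probability $q_{ij}\ge 0$, with $\sum_{k:(j,k)\in\mathcal{E}}q_{jk}\le 1$ for every node $j$. * A density $f_{ij}$ of carriers' opportunity costs, with distribution function $F_{ij}$, such that $\{f_{ij}>0\}$ is an interval contained in $[0,\infty)$, the virtual cost $\psi_{ij}(c)=c+F_{ij}(c)/f_{ij}(c)$ is strictly increasing on it, and $(x_1,x_2)\mapsto F_{ij}^{-1}(x_1/x_2)\,x_1$ is convex on $0\le x_1<x_2$. In period $t$ the state is $(\mathbf{S}_t,\mathbf{D}_t)$, where $S_{ijt}$ carriers and $D_{ijt}$ loads are available on lane $(i,j)$. A stationary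 policy $\pi$ maps the state to admissible shipper prices $r_{ijt}$ and to a direct carrier-side mechanism: as a function of the bids of all available carriers on all lanes, a lottery over the sets of carriers who are given a load on their lane (never more carriers on a lane than loads), so that carrier $s$ is given a load with probability $A^s$, and an expected payment $P^s$ to each carrier (measurable, and integrable both under truthful reporting and for any fixed own bid with the others truthful). The carriers' true costs are independent, with density $f_{ij}$ on lane $(i,j)$. Let $a^s(c)$ and $p^s(c)$ be the expectations of $A^s$ and $P^s$ when carrier $s$ bids $c$ and all others bid truthfully. The policy is incentive compatible (IC) if in every state, for every carrier $s$ on any lane $(i,j)$ and every true cost $C$ with $f_{ij}(C)>0$, $p^s(C)-a^s(C)C\ge p^s(c)-a^s(c)C$ for all bids $c\in\mathbb{R}$, and individually rational (IR) if $p^s(C)-a^s(C)C\ge 0$. The demand rates $d_{ij}(r_{ijt})$ that $\pi$ sets are assumed to be bounded over all states. Let $Y_{ijt}$ be the number of carriers on lane $(i,j)$ who are given a load and $P_{ijt}$ the total payment on the lane, under truthful reporting. Each of the $Y_{kit}$ carriers arriving at node $i$ independently becomes available on lane $(i,j)$ in the next period with probability $q_{ij}$ and otherwise leaves, which gives $Z_{ijt}$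 carriers on lane $(i,j)$; carriers who are given no load leave. Then $S_{ij,t+1}=Z_{ijt}+\Lambda_{ij,t+1}$ with $\Lambda_{ij,t+1}\sim\mathrm{Poisson}(\lambda_{ij})$, and $D_{ij,t+1}\sim\mathrm{Poisson}(d_{ij}(r_{ijt}))$, all independent given the past. The one-period expected profit is $$G^\pi(\mathbf{S}_t,\mathbf{D}_t)=\mathrm{E}\Big[\sum_{(i,j)\in\mathcal{E}} r_{ijt}d_{ij}(r_{ijt})-b_{ij}(D_{ijt}-Y_{ijt})-P_{ijt}\,\Big|\,\mathbf{S}_t,\mathbf{D}_t\Big].$$ **Fluid program (FA).** Maximize $$\sum_{(i,j)\in\mathcal{E}} r_{ij}(d_{ij})d_{ij}-F_{ij}^{-1}\Big(\frac{\bar y_{ij}}{\bar\lambda_{ij}}\Big)\bar y_{ij}-b_{ij}(d_{ij}-\bar y_{ij})$$ over $d_{ij},\bar y_{ij},\bar\lambda_{ij}\ge 0$ subject to $\sum_{k:(k,i)\in\mathcal{E}}q_{ij}\bar y_{ki}+\lambda_{ij}=\bar\lambda_{ij}$, $\bar y_{ij}\le d_{ij}$ and $\bar y_{ij}\le\bar\lambda_{ij}$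 for all $(i,j)\in\mathcal{E}$, where $d_{ij}\in\mathcal{D}_{ij}$ and $\bar y_{ij}/\bar\lambda_{ij}$ lies in the range of $F_{ij}$ (so that the objective is defined). **Theorem.** For every stationary policy $\pi$ as above that is IC and IR, and every initial law of $(\mathbf{S}_1,\mathbf{D}_1)$ with finite means (in particular every initial state), the long-run average profit satisfies $$\limsup_{T\to\infty}\frac1T\sum_{t=1}^{T}\mathrm{E}\big[G^\pi(\mathbf{S}_t,\mathbf{D}_t)\big]\;\le\;\gamma^{\mathsf{FA}},$$ where $\gamma^{\mathsf{FA}}\in(-\infty,+\infty]$ is the optimal value (supremum) of (FA), and the expectations are taken in $[-\infty,\infty)$. In particular, the bound holds for $\gamma^\pi=\lim_{T\to\infty}\frac1T\sum_{t=1}^T\mathrm{E}[G^\pi(\mathbf{S}_t,\mathbf{D}_t)]$ whenever the limit exists. -/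

import Mathlib

open MeasureTheory ProbabilityTheory Filter Set

noncomputable section

namespace Freight

/-- The lanes (origin-destination pairs) of a network: the arcs `(i, j)` in the finite set `E`.
Self-loops are allowed. -/
abbrev Lane {N : Type*} (E : Finset (N × N)) : Type _ := {e : N × N // e ∈ E}

/-- The law on `ℝ` with density `f`. -/
def densityLaw (f : ℝ → ℝ) : Measure ℝ := volume.withDensity (fun c => ENNReal.ofReal (f c))

/-- The distribution function of the law with density `f`. -/
def distFun (f : ℝ → ℝ) (c : ℝ) : ℝ := (densityLaw f).real (Iic c)

/-- The inverse of the distribution function of the law with density `f`. -/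
def invDistFun (f : ℝ → ℝ) (u : ℝ) : ℝ := sInf {c : ℝ | u ≤ distFun f c}

/-- The virtual cost function `ψ(c) = c + F(c) / f(c)`. -/
def virtualCost (f : ℝ → ℝ) (c : ℝ) : ℝ := c + distFun f c / f c

/-- The primitives of the freight marketplace on the network with arc set `E`. -/
structure Market {N : Type*} [DecidableEq N] (E : Finset (N × N)) where
  /-- Admissible shipper prices on each lane (the domain of the demand function). -/
  prices : Lane E → Set ℝ
  /-- Demand rate of a lane as a function of the shipper price. -/
  demand : Lane E → ℝ → ℝ
  /-- Unit penalty for an unmatched load. -/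
  penalty : Lane E → ℝ
  /-- Rate of the Poisson stream of new carriers. -/
  arrival : Lane E → ℝ
  /-- `stay (j, k)`: probability that a carrier who has just arrived at `j` with a load stays and
  becomes available on the lane `(j, k)` in the next period. -/
  stay : Lane E → ℝ
  /-- Density of a carrier's opportunity cost on a lane. -/
  density : Lane E → ℝ → ℝ
  demand_nonneg : ∀ l, ∀ r ∈ prices l, 0 ≤ demand l r
  demand_strictAnti : ∀ l, StrictAntiOn (demand l) (prices l)
  /-- The revenue `r(d) d` is a concave function of the demand rate `d`, where `r` is the inverse
  demand function; in particular the attainable demand rates form an interval. -/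
  revenue_concave : ∀ l, ConcaveOn ℝ (demand l '' prices l)
    (fun d => Function.invFunOn (demand l) (prices l) d * d)
  arrival_pos : ∀ l, 0 < arrival l
  stay_nonneg : ∀ l, 0 ≤ stay l
  stay_sum_le : ∀ j : N, ∑ l : Lane E, (if l.1.1 = j then stay l else 0) ≤ 1
  density_measurable : ∀ l, Measurable (density l)
  density_nonneg : ∀ l c, 0 ≤ density l c
  density_lintegral : ∀ l, ∫⁻ c, ENNReal.ofReal (density l c) = 1
  /-- The costs with positive density form an interval ... -/
  density_interval : ∀ l, {c | 0 < density l c}.OrdConnected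
  /-- ... of nonnegative numbers. -/
  cost_nonneg : ∀ l c, 0 < density l c → 0 ≤ c
  /-- Regularity: the virtual cost is strictly increasing. -/
  virtualCost_strictMono : ∀ l, StrictMonoOn (virtualCost (density l)) {c | 0 < density l c}
  /-- `F⁻¹(x₁ / x₂) x₁` is jointly convex. -/
  payment_convex : ∀ l, ConvexOn ℝ {x : ℝ × ℝ | 0 ≤ x.1 ∧ x.1 < x.2}
    (fun x => invDistFun (density l) (x.1 / x.2) * x.1)

variable {N : Type*} [DecidableEq N] {E : Finset (N × N)}

/-- System states `(S, D)`: numbers of available carriers and of loads on every lane. -/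
abbrev State (E : Finset (N × N)) : Type _ := (Lane E → ℕ) × (Lane E → ℕ)

/-- The carriers available in state `x`: a lane together with an index `s < S`. -/
abbrev Carrier (x : State E) : Type _ := Σ l : Lane E, Fin (x.1 l)

/-- Bid profiles: one bid for every available carrier, on all lanes. -/
abbrev Bids (x : State E) : Type _ := Carrier x → ℝ

/-- Realized allocations: `W k = true` iff the carrier `k` is given a load on its lane. -/
abbrev Outcome (x : State E) : Type _ := Carrier x → Bool

/-- `Y`: the number of carriers who transport a load on each lane. -/
def shipped {x : State E} (W : Outcome x) (l : Lane E) : ℕ :=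
  (Finset.univ.filter (fun s : Fin (x.1 l) => W ⟨l, s⟩ = true)).card

/-- A stationary policy. It maps every state to shipper prices and to a direct carrier-side
mechanism, i.e. a lottery over allocations and expected payments, as functions of the bids. -/
structure Policy (E : Finset (N × N)) where
  price : State E → Lane E → ℝ
  lottery : (x : State E) → Kernel (Bids x) (Outcome x)
  payment : (x : State E) → Carrier x → Bids x → ℝ

namespace Market

variable (M : Market E)

/-- The law of the opportunity cost of a carrier on lane `l`. -/
def costLaw (l : Lane E) : Measure ℝ := densityLaw (M.density l)

/-- The distribution function `F` of the opportunity cost on lane `l`. -/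
def F (l : Lane E) (c : ℝ) : ℝ := distFun (M.density l) c

/-- The inverse distribution function `F⁻¹` of the opportunity cost on lane `l`. -/
def invF (l : Lane E) (u : ℝ) : ℝ := invDistFun (M.density l) u

/-- The inverse demand function `r(d)`. -/
def invDemand (l : Lane E) (d : ℝ) : ℝ := Function.invFunOn (M.demand l) (M.prices l) d

/-- The joint law of the (independent) opportunity costs of all carriers in state `x`. -/
def profileLaw (x : State E) : Measure (Bids x) := Measure.pi (fun k => M.costLaw k.1)

/-! ### Mechanisms -/

/-- `A^k(c)`: the probability that carrier `k` is given a load under the bid profile `c`. -/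
def allocProb (π : Policy E) (x : State E) (k : Carrier x) (c : Bids x) : ℝ :=
  (π.lottery x c).real {W | W k = true}

/-- `a^k(c)`: the probability that carrier `k` is given a load if he bids `c` and all other
carriers report truthfully (the `k`-th entry of the random profile is overwritten). -/
def interimAlloc (π : Policy E) (x : State E) (k : Carrier x) (c : ℝ) : ℝ :=
  ∫ C, allocProb π x k (Function.update C k c) ∂M.profileLaw x

/-- `p^k(c)`: the expected payment to carrier `k` if he bids `c` and all other carriers report
truthfully. -/
def interimPayment (π : Policy E) (x : State E) (k : Carrier x) (c : ℝ) : ℝ :=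
  ∫ C, π.payment x k (Function.update C k c) ∂M.profileLaw x

/-- Bayesian incentive compatibility in every state: whatever his true cost `C`, no carrier gains
by a bid `c` different from `C`. -/
def IsIC (π : Policy E) : Prop :=
  ∀ (x : State E) (k : Carrier x) (C : ℝ), 0 < M.density k.1 C → ∀ c : ℝ,
    M.interimPayment π x k c - M.interimAlloc π x k c * C
      ≤ M.interimPayment π x k C - M.interimAlloc π x k C * C

/-- Individual rationality in every state. -/
def IsIR (π : Policy E) : Prop :=
  ∀ (x : State E) (k : Carrier x) (C : ℝ), 0 < M.density k.1 C →
    0 ≤ M.interimPayment π x k C - M.interimAlloc π x k C * C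

/-- The well-posed stationary policies. -/
structure IsPolicy (π : Policy E) : Prop where
  price_mem : ∀ x l, π.price x l ∈ M.prices l
  /-- The demand rates set by the policy stay bounded. -/
  demand_bounded : ∃ B : ℝ, ∀ x l, M.demand l (π.price x l) ≤ B
  lottery_markov : ∀ x, IsMarkovKernel (π.lottery x)
  /-- No lane is given more carriers than it has loads. -/
  shipped_le : ∀ x c l, ∀ᵐ W ∂π.lottery x c, shipped W l ≤ x.2 l
  payment_measurable : ∀ x k, Measurable (π.payment x k)
  payment_integrable : ∀ x k, Integrable (π.payment x k) (M.profileLaw x)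
  interimPayment_integrable : ∀ x k (c : ℝ),
    Integrable (fun C => π.payment x k (Function.update C k c)) (M.profileLaw x)

/-! ### The controlled Markov chain -/

/-- The law of the realized allocation in state `x` when all carriers report truthfully. -/
def outcomeLaw (π : Policy E) (x : State E) : Measure (Outcome x) :=
  (M.profileLaw x).bind (π.lottery x)

/-- What one carrier who has just arrived at node `j` adds to the supply of the next period: one
unit on the lane `l` out of `j` with probability `stay l`, nothing if he leaves. -/
def moveLaw (j : N) : Measure (Lane E → ℕ) :=
  ENNReal.ofReal (1 - ∑ l : Lane E, if l.1.1 = j then M.stay l else 0) • Measure.dirac 0 +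
    ∑ l : Lane E, (if l.1.1 = j then ENNReal.ofReal (M.stay l) else 0) •
      Measure.dirac (Pi.single l 1)

/-- The law of `Z` given that `Y` carriers shipped loads. They move independently, so that for
every node `i` the vector `(Z_ij)_j` is multinomial with parameters `∑_k Y_ki` and `(q_ij)_j`. -/
def stayLaw (Y : Lane E → ℕ) : Measure (Lane E → ℕ) :=
  (Measure.pi (fun k : (Σ l : Lane E, Fin (Y l)) => M.moveLaw k.1.1.2)).map (fun m => ∑ k, m k)

/-- The law of independent Poisson variables with the given rates. -/
def poissonLaw (rate : Lane E → ℝ) : Measure (Lane E → ℕ) :=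
  Measure.pi (fun l => poissonMeasure (rate l).toNNReal)

/-- One-step transition law `(S, D) ↦ (Z + Λ, D')`. -/
def step (π : Policy E) (x : State E) : Measure (State E) :=
  (((M.outcomeLaw π x).bind (fun W => M.stayLaw (shipped W))).prod
    ((poissonLaw M.arrival).prod
      (poissonLaw (fun l => M.demand l (π.price x l))))).map
    (fun w => (w.1 + w.2.1, w.2.2))

/-- The law of the state after `t` steps from the initial law `ν`. -/
def stateLaw (π : Policy E) (ν : Measure (State E)) : ℕ → Measure (State E)
  | 0 => ν
  | t + 1 => (stateLaw π ν t).bind (M.step π)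

/-- `E[Y | S, D]`. -/
def meanShipped (π : Policy E) (x : State E) (l : Lane E) : ℝ :=
  ∫ W, (shipped W l : ℝ) ∂M.outcomeLaw π x

/-- `E[P | S, D]`: the expected total payment to the carriers on a lane. -/
def meanPayment (π : Policy E) (x : State E) (l : Lane E) : ℝ :=
  ∫ C, ∑ s : Fin (x.1 l), π.payment x ⟨l, s⟩ C ∂M.profileLaw x

/-- `G(S, D)`: the expected profit of one period. -/
def profit (π : Policy E) (x : State E) : ℝ :=
  ∑ l : Lane E, (π.price x l * M.demand l (π.price x l)
    - M.penalty l * (x.2 l - M.meanShipped π x l) - M.meanPayment π x l)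

/-- The expectation `E[f⁺] - E[f⁻]` in the extended reals, so that a function with integrable
positive part and non-integrable negative part has expectation `-∞`. -/
def extExpectation {α : Type*} [MeasurableSpace α] (μ : Measure α) (f : α → ℝ) : EReal :=
  ((∫⁻ x, ENNReal.ofReal (f x) ∂μ : ENNReal) : EReal)
    - ((∫⁻ x, ENNReal.ofReal (-f x) ∂μ : ENNReal) : EReal)

/-- Expected profit per period over the first `T` periods. -/
def averageProfit (π : Policy E) (ν : Measure (State E)) (T : ℕ) : EReal :=
  (∑ t ∈ Finset.range T, extExpectation (M.stateLaw π ν t) (M.profit π)) / ((T : ℝ) : EReal)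

/-- The long-run average profit. It is taken as an upper limit, which is the limit whenever the
latter exists. -/
def longRunProfit (π : Policy E) (ν : Measure (State E)) : EReal :=
  limsup (M.averageProfit π ν) atTop

/-! ### The fluid program -/

/-- Feasible points `(d, y, lam)` of the fluid program, where `d` lies in the domain of the inverse
demand function and `y / lam` in the domain of `F⁻¹`. -/
structure FAFeasible (d y lam : Lane E → ℝ) : Prop where
  flow : ∀ l : Lane E,
    (∑ k : Lane E, if k.1.2 = l.1.1 then M.stay l * y k else 0) + M.arrival l = lam l
  y_le_d : ∀ l, y l ≤ d l
  y_le_lam : ∀ l, y l ≤ lam l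
  y_nonneg : ∀ l, 0 ≤ y l
  lam_nonneg : ∀ l, 0 ≤ lam l
  d_nonneg : ∀ l, 0 ≤ d l
  d_mem : ∀ l, d l ∈ M.demand l '' M.prices l
  ratio_mem : ∀ l, y l / lam l ∈ Set.range (M.F l)

/-- The objective of the fluid program. -/
def FAObjective (d y lam : Lane E → ℝ) : ℝ :=
  ∑ l : Lane E, (M.invDemand l (d l) * d l - M.invF l (y l / lam l) * y l
    - M.penalty l * (d l - y l))

/-- The optimal value of the fluid program. -/
def FAValue : EReal :=
  sSup {v : EReal | ∃ d y lam : Lane E → ℝ, M.FAFeasible d y lam ∧ v = M.FAObjective d y lam}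

end Market

end Freight

end

/-!
By the envelope formula an incentive compatible and individually rational mechanism pays on a lane,
in expectation, at least the sum of the virtual costs of the carriers who are given a load. With
`F` the distribution function and `ψ` the virtual cost, `E[ψ(C); C ≤ z] = z F(z)`, so assigning the
loads to the carriers with the smallest virtual costs shows that for every cost `z` the expected
payment is at least `ψ(z) (Y - F(z) S) + z F(z) S`, which is affine in the expected shipments `Y`
and the supply `S`. Revenues have affine majorants since they are concave in the demand rate.

Average the chain over the first `T` periods. Because all these bounds are affine, the average
profit is bounded by their values at the means of `S`, `D`, `Y` and the demand rates. The balance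
equations of the chain telescope, so these means satisfy the constraints of the fluid program up to
an error of order `1 / T`. Shrinking the shipments by a factor `1 - O(1 / T)` makes them feasible,
because the arrivals, which are positive, are not shrunk along. For `z = F⁻¹(y / lam)` at the shrunk
point the affine bounds are at most the fluid objective there, again up to `O(1 / T)`.
-/

namespace Freight

/-! ### The envelope formula -/

section Envelope

variable {I : Set ℝ} {U g : ℝ → ℝ}

theorem monotoneOn_of_subgradient (h : ∀ x ∈ I, ∀ y ∈ I, U x + g x * (y - x) ≤ U y) :
    MonotoneOn g I := by
  intro x hx y hy hxy
  rcases hxy.eq_or_lt with rfl | hlt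
  · exact le_rfl
  · have hmul : g x * (y - x) ≤ g y * (y - x) := by linarith [h x hx y hy, h y hy x hx]
    exact le_of_mul_le_mul_right hmul (sub_pos.2 hlt)

theorem deriv_eq_of_subgradient {x : ℝ} (hI : I ∈ nhds x) (hU : DifferentiableAt ℝ U x)
    (h : ∀ y ∈ I, U x + g x * (y - x) ≤ U y) : deriv U x = g x := by
  have hmin : IsLocalMin (fun y => U y - g x * y) x := by
    filter_upwards [hI] with y hy
    linarith [h y hy]
  have hderiv : HasDerivAt (fun y => U y - g x * y) (deriv U x - g x) x :=
    hU.hasDerivAt.sub (hasDerivAt_const_mul (g x))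
  exact sub_eq_zero.1 (hmin.hasDerivAt_eq_zero hderiv)

theorem exists_lipschitzOnWith_of_subgradient {c C : ℝ}
    (h : ∀ x ∈ Icc c C, ∀ y ∈ Icc c C, U x + g x * (y - x) ≤ U y) :
    ∃ K, LipschitzOnWith K U (Icc c C) := by
  have hmono := monotoneOn_of_subgradient h
  have hbound : ∀ x ∈ Icc c C, |g x| ≤ max |g c| |g C| := fun x hx =>
    abs_le_max_abs_abs (hmono ⟨le_rfl, hx.1.trans hx.2⟩ hx hx.1)
      (hmono hx ⟨hx.1.trans hx.2, le_rfl⟩ hx.2)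
  refine ⟨_, LipschitzOnWith.of_le_add_mul' (max |g c| |g C|) fun x hx y hy => ?_⟩
  have hxy : g x * (x - y) ≤ max |g c| |g C| * dist x y := by
    refine (le_abs_self _).trans ?_
    rw [abs_mul, Real.dist_eq]
    exact mul_le_mul_of_nonneg_right (hbound x hx) (abs_nonneg _)
  linarith [h x hx y hy]

theorem integral_eq_sub_of_subgradient {c C : ℝ} (hcC : c ≤ C)
    (h : ∀ x ∈ Icc c C, ∀ y ∈ Icc c C, U x + g x * (y - x) ≤ U y) :
    ∫ x in c..C, g x = U C - U c := by
  obtain ⟨K, hK⟩ := exists_lipschitzOnWith_of_subgradient h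
  rw [← uIcc_of_le hcC] at hK
  have hac := hK.absolutelyContinuousOnInterval
  rw [← hac.integral_deriv_eq_sub]
  refine intervalIntegral.integral_congr_ae_restrict ?_
  rw [uIoc_of_le hcC, ← Measure.restrict_congr_set Ioo_ae_eq_Ioc, EventuallyEq,
    ae_restrict_iff' measurableSet_Ioo]
  filter_upwards [hac.ae_differentiableAt] with x hdiff hx
  have hxI := Ioo_subset_Icc_self hx
  exact (deriv_eq_of_subgradient (Icc_mem_nhds hx.1 hx.2) (hdiff (uIcc_of_le hcC ▸ hxI))
    (h x hxI)).symm

theorem setLIntegral_le_of_subgradient {a : ℝ → ℝ} (hI : I.OrdConnected)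
    (h : ∀ x ∈ I, ∀ y ∈ I, U x - a x * (y - x) ≤ U y)
    (ha : ∀ x ∈ I, 0 ≤ a x) (hU : ∀ x ∈ I, 0 ≤ U x) {c : ℝ} (hc : c ∈ I) :
    ∫⁻ x in I ∩ Ici c, ENNReal.ofReal (a x) ≤ ENNReal.ofReal (U c) := by
  have hsubgrad : ∀ x ∈ I, ∀ y ∈ I, U x + -a x * (y - x) ≤ U y := fun x hx y hy => by
    linarith [h x hx y hy]
  have : Nonempty I := ⟨⟨c, hc⟩⟩
  obtain ⟨u, hu, hut⟩ := exists_seq_monotone_tendsto_atTop_atTop I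
  have hcover : I ∩ Ici c ⊆ ⋃ n, Icc c (u n : ℝ) := by
    rintro x ⟨hx, hcx⟩
    obtain ⟨n, hn⟩ := (hut.eventually_ge_atTop ⟨x, hx⟩).exists
    exact mem_iUnion.2 ⟨n, hcx, hn⟩
  have hdirected : Directed (· ⊆ ·) fun n => Icc c (u n : ℝ) :=
    Monotone.directed_le fun m n hmn => Icc_subset_Icc le_rfl (hu hmn)
  refine (lintegral_mono_set hcover).trans ?_
  rw [setLIntegral_iUnion_of_directed _ hdirected]
  refine iSup_le fun n => ?_
  rcases lt_or_ge (u n : ℝ) c with hlt | hle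
  · simp [Icc_eq_empty_of_lt hlt]
  have hsub : Icc c (u n : ℝ) ⊆ I := hI.out hc (u n).2
  have hint : IntegrableOn a (Icc c (u n : ℝ)) := by
    simpa using (((monotoneOn_of_subgradient hsubgrad).mono hsub).integrableOn_isCompact
      (μ := volume) isCompact_Icc).neg
  rw [← ofReal_integral_eq_lintegral_ofReal hint
    (ae_restrict_of_forall_mem measurableSet_Icc fun x hx => ha x (hsub hx))]
  refine ENNReal.ofReal_le_ofReal ?_
  have henvelope := integral_eq_sub_of_subgradient hle fun x hx y hy =>
    hsubgrad x (hsub hx) y (hsub hy)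
  rw [intervalIntegral.integral_neg] at henvelope
  rw [integral_Icc_eq_integral_Ioc, ← intervalIntegral.integral_of_le hle]
  linarith [hU _ (u n).2]

end Envelope

/-! ### Virtual costs -/

theorem lintegral_mul_measure_Iic {α : Type*} [TopologicalSpace α] [LinearOrder α]
    [OrderClosedTopology α] [SecondCountableTopology α] [MeasurableSpace α]
    [OpensMeasurableSpace α] (μ ν : Measure α) [SFinite μ] [SFinite ν] {g : α → ENNReal}
    (hg : Measurable g) :
    ∫⁻ x, g x * ν (Iic x) ∂μ = ∫⁻ c, ∫⁻ x in Ici c, g x ∂μ ∂ν := by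
  have hind : Measurable fun p : α × α => {q : α × α | q.2 ≤ q.1}.indicator (fun q => g q.1) p :=
    (hg.comp measurable_fst).indicator (measurableSet_le measurable_snd measurable_fst)
  calc ∫⁻ x, g x * ν (Iic x) ∂μ
      = ∫⁻ x, ∫⁻ c, {q : α × α | q.2 ≤ q.1}.indicator (fun q => g q.1) (x, c) ∂ν ∂μ := by
        refine lintegral_congr fun x => ?_
        rw [← lintegral_indicator_const measurableSet_Iic]
        rfl
    _ = ∫⁻ c, ∫⁻ x, {q : α × α | q.2 ≤ q.1}.indicator (fun q => g q.1) (x, c) ∂μ ∂ν :=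
        lintegral_lintegral_swap hind.aemeasurable
    _ = ∫⁻ c, ∫⁻ x in Ici c, g x ∂μ ∂ν := by
        refine lintegral_congr fun c => ?_
        rw [← lintegral_indicator measurableSet_Ici]
        rfl

theorem distFun_nonneg (f : ℝ → ℝ) (c : ℝ) : 0 ≤ distFun f c := measureReal_nonneg

theorem self_le_virtualCost {f : ℝ → ℝ} {c : ℝ} (hfc : 0 < f c) : c ≤ virtualCost f c :=
  le_add_of_nonneg_right (div_nonneg (distFun_nonneg f c) hfc.le)

theorem isProbabilityMeasure_densityLaw {f : ℝ → ℝ} (h : ∫⁻ c, ENNReal.ofReal (f c) = 1) :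
    IsProbabilityMeasure (densityLaw f) :=
  ⟨by rw [densityLaw, withDensity_apply _ MeasurableSet.univ, Measure.restrict_univ, h]⟩

/-- Incentive compatibility and individual rationality, in the eyes of one carrier whose cost has
density `f`: by the bid `c` he is given a load with probability `a c` and the payment `p c`. -/
structure IsTruthful (f a p : ℝ → ℝ) : Prop where
  ic : ∀ C, 0 < f C → ∀ c, p c - a c * C ≤ p C - a C * C
  ir : ∀ C, 0 < f C → 0 ≤ p C - a C * C

section Density

variable {f : ℝ → ℝ} (hf : Measurable f)

section Support

include hf

theorem ae_densityLaw_pos : ∀ᵐ c ∂densityLaw f, 0 < f c := by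
  rw [densityLaw, ae_withDensity_iff hf.ennreal_ofReal]
  exact ae_of_all _ fun c hc => by simpa using hc

theorem lintegral_mul_div_densityLaw {g : ℝ → ENNReal} {v : ℝ → ℝ} (hg : Measurable g)
    (hv : Measurable v) :
    ∫⁻ c, g c * ENNReal.ofReal (v c / f c) ∂densityLaw f =
      ∫⁻ c in {c | 0 < f c}, g c * ENNReal.ofReal (v c) := by
  rw [densityLaw, lintegral_withDensity_eq_lintegral_mul _ hf.ennreal_ofReal (by fun_prop),
    ← lintegral_indicator (measurableSet_lt measurable_const hf)]
  refine lintegral_congr fun c => ?_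
  by_cases hc : 0 < f c
  · rw [indicator_of_mem (a := c) hc, Pi.mul_apply, mul_left_comm, ← ENNReal.ofReal_mul hc.le,
      mul_div_cancel₀ _ hc.ne']
  · rw [indicator_of_notMem (a := c) hc, Pi.mul_apply, ENNReal.ofReal_of_nonpos (not_lt.1 hc),
      zero_mul]

theorem ae_virtualCost_nonneg (hnn : ∀ c, 0 < f c → 0 ≤ c) :
    ∀ᵐ c ∂densityLaw f, 0 ≤ virtualCost f c :=
  (ae_densityLaw_pos hf).mono fun c hc => (hnn c hc).trans (self_le_virtualCost hc)

theorem ae_payment_nonneg {a p : ℝ → ℝ} (hnn : ∀ c, 0 < f c → 0 ≤ c) (ha0 : ∀ c, 0 ≤ a c)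
    (hIR : ∀ C, 0 < f C → 0 ≤ p C - a C * C) : 0 ≤ᵐ[densityLaw f] p :=
  (ae_densityLaw_pos hf).mono fun c hc =>
    (mul_nonneg (ha0 c) (hnn c hc)).trans (sub_nonneg.1 (hIR c hc))

end Support

variable [IsProbabilityMeasure (densityLaw f)]

theorem monotone_distFun (f : ℝ → ℝ) [IsProbabilityMeasure (densityLaw f)] :
    Monotone (distFun f) :=
  fun _ _ hxy => measureReal_mono (Iic_subset_Iic.2 hxy)

include hf

theorem measurable_virtualCost : Measurable (virtualCost f) :=
  measurable_id.add ((monotone_distFun f).measurable.div hf)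

/- Exchanging the integrals over `x` and `c ≤ x` turns the term `F / f` of the virtual cost into
the information rent `∫ x in Ici c, g x`. -/
theorem lintegral_mul_virtualCost (hnn : ∀ c, 0 < f c → 0 ≤ c) {g : ℝ → ENNReal}
    (hg : Measurable g) :
    ∫⁻ c, g c * ENNReal.ofReal (virtualCost f c) ∂densityLaw f =
      ∫⁻ c, (g c * ENNReal.ofReal c + ∫⁻ x in {x | 0 < f x} ∩ Ici c, g x) ∂densityLaw f := by
  have hF := (monotone_distFun f).measurable
  calc ∫⁻ c, g c * ENNReal.ofReal (virtualCost f c) ∂densityLaw f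
      = ∫⁻ c, (g c * ENNReal.ofReal c + g c * ENNReal.ofReal (distFun f c / f c))
          ∂densityLaw f := by
        refine lintegral_congr_ae ((ae_densityLaw_pos hf).mono fun c hc => ?_)
        dsimp only
        rw [virtualCost, ENNReal.ofReal_add (hnn c hc)
          (div_nonneg (distFun_nonneg f c) hc.le), mul_add]
    _ = ∫⁻ c, g c * ENNReal.ofReal c ∂densityLaw f
          + ∫⁻ c in {c | 0 < f c}, g c * densityLaw f (Iic c) := by
        rw [lintegral_add_left (by fun_prop), lintegral_mul_div_densityLaw hf hg hF]
        simp only [distFun, ofReal_measureReal (measure_ne_top _ _)]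
    _ = _ := by
        rw [lintegral_mul_measure_Iic _ _ hg, lintegral_add_left (by fun_prop)]
        simp only [Measure.restrict_restrict measurableSet_Ici, inter_comm]

theorem setLIntegral_virtualCost_Iic (hI : {c | 0 < f c}.OrdConnected)
    (hnn : ∀ c, 0 < f c → 0 ≤ c) {z : ℝ} (hz : 0 < f z) :
    ∫⁻ c in Iic z, ENNReal.ofReal (virtualCost f c) ∂densityLaw f =
      ENNReal.ofReal (z * distFun f z) := by
  have hrent : ∀ᵐ c ∂densityLaw f, (Iic z).indicator (1 : ℝ → ENNReal) c * ENNReal.ofReal c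
      + ∫⁻ x in {x | 0 < f x} ∩ Ici c, (Iic z).indicator 1 x =
        (Iic z).indicator (fun _ => ENNReal.ofReal z) c := by
    filter_upwards [ae_densityLaw_pos hf] with c hc
    rw [lintegral_indicator_one measurableSet_Iic, Measure.restrict_apply measurableSet_Iic]
    by_cases hcz : c ≤ z
    · have hIcc : Iic z ∩ ({x | 0 < f x} ∩ Ici c) = Icc c z :=
        Subset.antisymm (fun x hx => ⟨hx.2.2, hx.1⟩)
          fun x hx => ⟨hx.2, hI.out hc hz hx, hx.1⟩
      rw [hIcc, Real.volume_Icc, indicator_of_mem (mem_Iic.2 hcz),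
        indicator_of_mem (mem_Iic.2 hcz), Pi.one_apply, one_mul,
        ← ENNReal.ofReal_add (hnn c hc) (sub_nonneg.2 hcz), add_sub_cancel]
    · have hempty : Iic z ∩ ({x | 0 < f x} ∩ Ici c) = ∅ :=
        eq_empty_of_forall_notMem fun x hx => hcz (hx.2.2.trans hx.1)
      simp [hempty, hcz]
  calc ∫⁻ c in Iic z, ENNReal.ofReal (virtualCost f c) ∂densityLaw f
      = ∫⁻ c, (Iic z).indicator 1 c * ENNReal.ofReal (virtualCost f c) ∂densityLaw f := by
        rw [← lintegral_indicator measurableSet_Iic]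
        simp only [indicator, Pi.one_apply, ite_mul, one_mul, zero_mul]
    _ = ∫⁻ c, (Iic z).indicator (fun _ => ENNReal.ofReal z) c ∂densityLaw f := by
        rw [lintegral_mul_virtualCost hf hnn (measurable_one.indicator measurableSet_Iic),
          lintegral_congr_ae hrent]
    _ = ENNReal.ofReal (z * distFun f z) := by
        rw [lintegral_indicator_const measurableSet_Iic, distFun,
          ENNReal.ofReal_mul (hnn z hz), ofReal_measureReal]

theorem integrableOn_virtualCost_Iic (hI : {c | 0 < f c}.OrdConnected)
    (hnn : ∀ c, 0 < f c → 0 ≤ c) {z : ℝ} (hz : 0 < f z) :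
    IntegrableOn (virtualCost f) (Iic z) (densityLaw f) :=
  (lintegral_ofReal_ne_top_iff_integrable (measurable_virtualCost hf).aestronglyMeasurable
    (ae_restrict_of_ae (ae_virtualCost_nonneg hf hnn))).1
    (setLIntegral_virtualCost_Iic hf hI hnn hz ▸ ENNReal.ofReal_ne_top)

theorem setIntegral_virtualCost_Iic (hI : {c | 0 < f c}.OrdConnected)
    (hnn : ∀ c, 0 < f c → 0 ≤ c) {z : ℝ} (hz : 0 < f z) :
    ∫ c in Iic z, virtualCost f c ∂densityLaw f = z * distFun f z := by
  rw [integral_eq_lintegral_of_nonneg_ae (ae_restrict_of_ae (ae_virtualCost_nonneg hf hnn))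
      (measurable_virtualCost hf).aestronglyMeasurable,
    setLIntegral_virtualCost_Iic hf hI hnn hz,
    ENNReal.toReal_ofReal (mul_nonneg (hnn z hz) (distFun_nonneg f z))]

section Truthful

variable {a p : ℝ → ℝ}

theorem lintegral_mul_virtualCost_le_integral_payment (hI : {c | 0 < f c}.OrdConnected)
    (hnn : ∀ c, 0 < f c → 0 ≤ c) (ha : Measurable a) (ha0 : ∀ c, 0 ≤ a c)
    (hp : Integrable p (densityLaw f))
    (h : IsTruthful f a p) :
    ∫⁻ c, ENNReal.ofReal (a c * virtualCost f c) ∂densityLaw f ≤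
      ENNReal.ofReal (∫ c, p c ∂densityLaw f) := by
  simp_rw [ENNReal.ofReal_mul (ha0 _)]
  rw [lintegral_mul_virtualCost hf hnn ha.ennreal_ofReal,
    ofReal_integral_eq_lintegral_ofReal hp (ae_payment_nonneg hf hnn ha0 h.ir)]
  refine lintegral_mono_ae ((ae_densityLaw_pos hf).mono fun c hc => ?_)
  have hrent : ∫⁻ x in {x | 0 < f x} ∩ Ici c, ENNReal.ofReal (a x) ≤
      ENNReal.ofReal (p c - a c * c) :=
    setLIntegral_le_of_subgradient (U := fun c => p c - a c * c) hI
      (fun x _ y hy => by linarith [h.ic y hy x]) (fun x _ => ha0 x) h.ir hc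
  calc ENNReal.ofReal (a c) * ENNReal.ofReal c
        + ∫⁻ x in {x | 0 < f x} ∩ Ici c, ENNReal.ofReal (a x)
      ≤ ENNReal.ofReal (a c * c) + ENNReal.ofReal (p c - a c * c) := by
        rw [← ENNReal.ofReal_mul (ha0 c)]
        gcongr
    _ = ENNReal.ofReal (p c) := by
        rw [← ENNReal.ofReal_add (mul_nonneg (ha0 c) (hnn c hc)) (h.ir c hc), add_sub_cancel]

theorem integrable_mul_virtualCost (hI : {c | 0 < f c}.OrdConnected)
    (hnn : ∀ c, 0 < f c → 0 ≤ c) (ha : Measurable a) (ha0 : ∀ c, 0 ≤ a c)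
    (hp : Integrable p (densityLaw f))
    (h : IsTruthful f a p) :
    Integrable (fun c => a c * virtualCost f c) (densityLaw f) :=
  (lintegral_ofReal_ne_top_iff_integrable (ha.mul (measurable_virtualCost hf)).aestronglyMeasurable
    ((ae_virtualCost_nonneg hf hnn).mono fun c hc => mul_nonneg (ha0 c) hc)).1
    (ne_top_of_le_ne_top ENNReal.ofReal_ne_top
      (lintegral_mul_virtualCost_le_integral_payment hf hI hnn ha ha0 hp h))

theorem integral_mul_virtualCost_le_integral_payment (hI : {c | 0 < f c}.OrdConnected)
    (hnn : ∀ c, 0 < f c → 0 ≤ c) (ha : Measurable a) (ha0 : ∀ c, 0 ≤ a c)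
    (hp : Integrable p (densityLaw f))
    (h : IsTruthful f a p) :
    ∫ c, a c * virtualCost f c ∂densityLaw f ≤ ∫ c, p c ∂densityLaw f := by
  rw [integral_eq_lintegral_of_nonneg_ae
    ((ae_virtualCost_nonneg hf hnn).mono fun c hc => mul_nonneg (ha0 c) hc)
    (ha.mul (measurable_virtualCost hf)).aestronglyMeasurable]
  exact ENNReal.toReal_le_of_le_ofReal (integral_nonneg_of_ae (ae_payment_nonneg hf hnn ha0 h.ir))
    (lintegral_mul_virtualCost_le_integral_payment hf hI hnn ha ha0 hp h)

/- Since `(a c - 1_{c ≤ z}) (ψ c - ψ z) ≥ 0`, no allocation is cheaper than the posted price `z`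
corrected at the marginal cost `ψ z`. -/
theorem tangent_le_integral_payment (hI : {c | 0 < f c}.OrdConnected)
    (hnn : ∀ c, 0 < f c → 0 ≤ c) (hψ : MonotoneOn (virtualCost f) {c | 0 < f c})
    (ha : Measurable a) (ha0 : ∀ c, 0 ≤ a c) (ha1 : ∀ c, a c ≤ 1)
    (hp : Integrable p (densityLaw f))
    (h : IsTruthful f a p) {z : ℝ} (hz : 0 < f z) :
    virtualCost f z * (∫ c, a c ∂densityLaw f - distFun f z) + z * distFun f z
      ≤ ∫ c, p c ∂densityLaw f := by
  have hai : Integrable a (densityLaw f) := .of_bound ha.aestronglyMeasurable 1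
    (ae_of_all _ fun c => (Real.norm_of_nonneg (ha0 c)).trans_le (ha1 c))
  have hone : Integrable ((Iic z).indicator (1 : ℝ → ℝ)) (densityLaw f) :=
    (integrable_const (1 : ℝ)).indicator measurableSet_Iic
  have haψ := integrable_mul_virtualCost hf hI hnn ha ha0 hp h
  have hψz := (integrableOn_virtualCost_Iic hf hI hnn hz).integrable_indicator measurableSet_Iic
  have hexchange : ∫ c, virtualCost f z * (a c - (Iic z).indicator 1 c) ∂densityLaw f ≤
      ∫ c, (a c * virtualCost f c - (Iic z).indicator (virtualCost f) c) ∂densityLaw f := by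
    refine integral_mono_ae ((hai.sub hone).const_mul _) (haψ.sub hψz)
      ((ae_densityLaw_pos hf).mono fun c hc => ?_)
    by_cases hcz : c ≤ z
    · simp only [indicator_of_mem (mem_Iic.2 hcz), Pi.one_apply]
      linarith [mul_le_mul_of_nonneg_left (hψ hc hz hcz) (sub_nonneg.2 (ha1 c))]
    · simp only [indicator_of_notMem (notMem_Iic.2 (not_le.1 hcz))]
      linarith [mul_le_mul_of_nonneg_left (hψ hz hc (le_of_not_ge hcz)) (ha0 c)]
  rw [integral_const_mul, integral_sub hai hone, integral_indicator_one measurableSet_Iic,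
    integral_sub haψ hψz, integral_indicator measurableSet_Iic,
    setIntegral_virtualCost_Iic hf hI hnn hz] at hexchange
  change virtualCost f z * (_ - distFun f z) ≤ _ at hexchange
  linarith [integral_mul_virtualCost_le_integral_payment hf hI hnn ha ha0 hp h]

end Truthful

end Density

/-! ### Quantiles -/

theorem continuous_cdf (P : Measure ℝ) [IsProbabilityMeasure P] [NullSingletonClass P] :
    Continuous (cdf P) := by
  refine continuous_iff_continuousAt.2 fun a => ?_
  have hatom : cdf P a ≤ Function.leftLim (cdf P) a := by
    have hzero := (cdf P).measure_singleton a
    rwa [measure_cdf, measure_singleton, eq_comm, ENNReal.ofReal_eq_zero, sub_nonpos] at hzero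
  rw [(monotone_cdf P).continuousAt_iff_leftLim_eq_rightLim, (cdf P).rightLim_eq]
  exact le_antisymm ((monotone_cdf P).leftLim_le le_rfl) hatom

section Quantile

variable {f : ℝ → ℝ} [IsProbabilityMeasure (densityLaw f)]

theorem distFun_eq_cdf : distFun f = cdf (densityLaw f) :=
  funext fun c => (cdf_eq_real _ c).symm

theorem continuous_distFun : Continuous (distFun f) := by
  have : NullSingletonClass (densityLaw f) :=
    nullSingletonClass_withDensity _
  exact distFun_eq_cdf (f := f) ▸ continuous_cdf _

theorem distFun_invDistFun {u : ℝ} (hu : u ∈ Ioo (0 : ℝ) 1) :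
    distFun f (invDistFun f u) = u := by
  have hmono := monotone_distFun f
  obtain ⟨v, hv⟩ : ∃ v, distFun f v < u := by
    rw [distFun_eq_cdf]
    exact ((tendsto_cdf_atBot _).eventually_lt_const hu.1).exists
  obtain ⟨w, hw⟩ : ∃ w, u < distFun f w := by
    rw [distFun_eq_cdf]
    exact ((tendsto_cdf_atTop _).eventually_const_lt hu.2).exists
  obtain ⟨c, hc⟩ :=
    mem_range_of_exists_le_of_exists_ge continuous_distFun ⟨v, hv.le⟩ ⟨w, hw.le⟩
  have hbdd : BddBelow {c : ℝ | u ≤ distFun f c} :=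
    ⟨v, fun x hx => (hmono.reflect_lt (hv.trans_le hx)).le⟩
  have hmem : invDistFun f u ∈ {c : ℝ | u ≤ distFun f c} :=
    (isClosed_le continuous_const continuous_distFun).csInf_mem ⟨c, hc.ge⟩ hbdd
  exact le_antisymm ((hmono (csInf_le hbdd hc.ge)).trans_eq hc) hmem

theorem mem_range_distFun (hf : Measurable f) (hnn : ∀ c, 0 < f c → 0 ≤ c) {u : ℝ}
    (hu : u ∈ Ico (0 : ℝ) 1) : u ∈ range (distFun f) := by
  rcases hu.1.eq_or_lt with rfl | hpos
  · refine ⟨-1, (measureReal_eq_zero_iff (measure_ne_top _ _)).2 <|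
      measure_eq_zero_iff_ae_notMem.2 ((ae_densityLaw_pos hf).mono fun c hc hle => ?_)⟩
    linarith [hnn c hc, mem_Iic.1 hle]
  · exact ⟨_, distFun_invDistFun ⟨hpos, hu.2⟩⟩

theorem pos_of_distFun_mem_Ioo (hf : Measurable f) (hI : {c | 0 < f c}.OrdConnected) {z : ℝ}
    (hz : distFun f z ∈ Ioo (0 : ℝ) 1) : 0 < f z := by
  have hpos := ae_densityLaw_pos hf
  have hlow : densityLaw f (Iic z) ≠ 0 := fun h0 => hz.1.ne' <| by
    rw [distFun, measureReal_def, h0, ENNReal.toReal_zero]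
  have hup : densityLaw f (Iic z)ᶜ ≠ 0 := fun h0 =>
    hz.2.ne <| by
    rw [prob_compl_eq_zero_iff measurableSet_Iic] at h0
    rw [distFun, measureReal_def, h0, ENNReal.toReal_one]
  obtain ⟨x, hx, hfx⟩ := Measure.exists_mem_of_measure_ne_zero_of_ae hlow (ae_restrict_of_ae hpos)
  obtain ⟨y, hy, hfy⟩ := Measure.exists_mem_of_measure_ne_zero_of_ae hup (ae_restrict_of_ae hpos)
  exact hI.out hfx hfy ⟨hx, (notMem_Iic.1 hy).le⟩

end Quantile

/-! ### Resampling a coordinate of a product measure -/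

section Resampling

variable {ι : Type*} [Fintype ι] [DecidableEq ι] {α : ι → Type*} [∀ i, MeasurableSpace (α i)]
  (μ : ∀ i, Measure (α i)) [∀ i, IsProbabilityMeasure (μ i)]

theorem measurePreserving_update (k : ι) :
    MeasurePreserving (fun q : α k × (∀ i, α i) => Function.update q.2 k q.1)
      ((μ k).prod (Measure.pi μ)) (Measure.pi μ) := by
  have hm : Measurable (fun q : α k × (∀ i, α i) => Function.update q.2 k q.1) :=
    measurable_update'.comp measurable_swap
  refine ⟨hm, (Measure.pi_eq fun s hs => ?_).symm⟩
  have hpreimage : (fun q : α k × (∀ i, α i) => Function.update q.2 k q.1) ⁻¹' univ.pi s =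
      s k ×ˢ univ.pi (Function.update s k univ) := by
    ext q
    simp only [mem_preimage, mem_univ_pi, mem_prod, Function.forall_update_iff _ fun i a => a ∈ s i,
      Function.forall_update_iff _ fun i t => q.2 i ∈ t, mem_univ, true_and]
  rw [Measure.map_apply hm (MeasurableSet.univ_pi hs), hpreimage, Measure.prod_prod,
    Measure.pi_pi, ← Finset.mul_prod_erase _ _ (Finset.mem_univ k),
    ← Finset.mul_prod_erase _ _ (Finset.mem_univ k), Function.update_self, measure_univ, one_mul]
  congr 1
  exact Finset.prod_congr rfl fun i hi => by
    rw [Function.update_of_ne (Finset.ne_of_mem_erase hi)]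

variable {F : Type*} [NormedAddCommGroup F] [NormedSpace ℝ F] {g : (∀ i, α i) → F}

theorem integrable_integral_update (hg : Integrable g (Measure.pi μ)) (k : ι) :
    Integrable (fun c => ∫ C, g (Function.update C k c) ∂Measure.pi μ) (μ k) :=
  ((measurePreserving_update μ k).integrable_comp_of_integrable hg).integral_prod_left

theorem integral_integral_update (hg : Integrable g (Measure.pi μ)) (k : ι) :
    ∫ c, ∫ C, g (Function.update C k c) ∂Measure.pi μ ∂μ k = ∫ C, g C ∂Measure.pi μ := by
  have hmp := measurePreserving_update μ k
  calc ∫ c, ∫ C, g (Function.update C k c) ∂Measure.pi μ ∂μ k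
      = ∫ q, g (Function.update q.2 k q.1) ∂(μ k).prod (Measure.pi μ) :=
        (integral_prod _ (hmp.integrable_comp_of_integrable hg)).symm
    _ = ∫ C, g C ∂(((μ k).prod (Measure.pi μ)).map fun q => Function.update q.2 k q.1) :=
        (integral_map hmp.aemeasurable (hmp.map_eq.symm ▸ hg.aestronglyMeasurable)).symm
    _ = ∫ C, g C ∂Measure.pi μ := by rw [hmp.map_eq]

theorem stronglyMeasurable_integral_update (hg : StronglyMeasurable g) (k : ι) :
    StronglyMeasurable fun c => ∫ C, g (Function.update C k c) ∂Measure.pi μ :=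
  (hg.comp_measurable (measurePreserving_update μ k).measurable).integral_prod_right'

end Resampling

/-! ### Mechanisms -/

namespace Market

variable {N : Type*} {E : Finset (N × N)}

theorem measurable_allocProb (π : Policy E) (x : State E) (k : Carrier x) :
    Measurable (allocProb π x k) :=
  ((π.lottery x).measurable_coe .of_discrete).ennreal_toReal

theorem allocProb_nonneg (π : Policy E) (x : State E) (k : Carrier x) (c : Bids x) :
    0 ≤ allocProb π x k c :=
  measureReal_nonneg

theorem shipped_eq_sum_indicator {x : State E} (W : Outcome x) (l : Lane E) :
    (shipped W l : ℝ) =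
      ∑ s : Fin (x.1 l), {W : Outcome x | W ⟨l, s⟩ = true}.indicator (fun _ => (1 : ℝ)) W := by
  simp [shipped, indicator, Finset.sum_boole]

theorem shipped_le_supply {x : State E} (W : Outcome x) (l : Lane E) : shipped W l ≤ x.1 l :=
  (Finset.card_filter_le _ _).trans (by simp)

variable [DecidableEq N] (M : Market E) {π : Policy E}

instance (l : Lane E) : IsProbabilityMeasure (densityLaw (M.density l)) :=
  isProbabilityMeasure_densityLaw (M.density_lintegral l)

instance (l : Lane E) : IsProbabilityMeasure (M.costLaw l) :=
  inferInstanceAs (IsProbabilityMeasure (densityLaw (M.density l)))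

instance (x : State E) : IsProbabilityMeasure (M.profileLaw x) := by
  unfold profileLaw; infer_instance

variable {M}

theorem interimAlloc_nonneg (π : Policy E) (x : State E) (k : Carrier x) (c : ℝ) :
    0 ≤ M.interimAlloc π x k c :=
  integral_nonneg fun _ => allocProb_nonneg π x k _

theorem isTruthful_interim (hIC : M.IsIC π) (hIR : M.IsIR π) (x : State E) (k : Carrier x) :
    IsTruthful (M.density k.1) (M.interimAlloc π x k) (M.interimPayment π x k) :=
  ⟨hIC x k, hIR x k⟩

theorem meanShipped_nonneg (π : Policy E) (x : State E) (l : Lane E) :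
    0 ≤ M.meanShipped π x l :=
  integral_nonneg fun _ => Nat.cast_nonneg _

namespace IsPolicy

variable (hπ : M.IsPolicy π)

include hπ

theorem isProbabilityMeasure_outcomeLaw (x : State E) :
    IsProbabilityMeasure (M.outcomeLaw π x) := by
  have := hπ.lottery_markov x
  unfold outcomeLaw; infer_instance

theorem allocProb_le_one (x : State E) (k : Carrier x) (c : Bids x) :
    allocProb π x k c ≤ 1 :=
  have := hπ.lottery_markov x
  measureReal_le_one

theorem integrable_allocProb (x : State E) (k : Carrier x) (μ : Measure (Bids x))
    [IsFiniteMeasure μ] : Integrable (allocProb π x k) μ :=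
  .of_bound (measurable_allocProb π x k).aestronglyMeasurable 1 <| ae_of_all _ fun c =>
    (Real.norm_of_nonneg (allocProb_nonneg π x k c)).trans_le (hπ.allocProb_le_one x k c)

theorem interimAlloc_le_one (x : State E) (k : Carrier x) (c : ℝ) :
    M.interimAlloc π x k c ≤ 1 := by
  refine (integral_mono_of_nonneg (ae_of_all _ fun C => allocProb_nonneg π x k _)
    (integrable_const (1 : ℝ)) (ae_of_all _ fun C => hπ.allocProb_le_one x k _)).trans ?_
  simp

theorem integral_interimAlloc (x : State E) (k : Carrier x) :
    ∫ c, M.interimAlloc π x k c ∂M.costLaw k.1 = ∫ C, allocProb π x k C ∂M.profileLaw x :=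
  integral_integral_update (fun k : Carrier x => M.costLaw k.1)
    (hπ.integrable_allocProb x k (M.profileLaw x)) k

theorem integral_interimPayment (x : State E) (k : Carrier x) :
    ∫ c, M.interimPayment π x k c ∂M.costLaw k.1 = ∫ C, π.payment x k C ∂M.profileLaw x :=
  integral_integral_update (fun k : Carrier x => M.costLaw k.1) (hπ.payment_integrable x k) k

theorem tangent_le_integral_payment (hIC : M.IsIC π) (hIR : M.IsIR π) (x : State E)
    (k : Carrier x) {z : ℝ} (hz : 0 < M.density k.1 z) :
    virtualCost (M.density k.1) z * (∫ C, allocProb π x k C ∂M.profileLaw x - M.F k.1 z)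
      + z * M.F k.1 z ≤ ∫ C, π.payment x k C ∂M.profileLaw x := by
  rw [← hπ.integral_interimAlloc, ← hπ.integral_interimPayment]
  exact Freight.tangent_le_integral_payment (M.density_measurable k.1) (M.density_interval k.1)
    (M.cost_nonneg k.1) (M.virtualCost_strictMono k.1).monotoneOn
    (stronglyMeasurable_integral_update _ (measurable_allocProb π x k).stronglyMeasurable
      k).measurable
    (interimAlloc_nonneg π x k) (hπ.interimAlloc_le_one x k)
    (integrable_integral_update _ (hπ.payment_integrable x k) k)
    (isTruthful_interim hIC hIR x k) hz

theorem integral_payment_nonneg (hIR : M.IsIR π) (x : State E) (k : Carrier x) :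
    0 ≤ ∫ C, π.payment x k C ∂M.profileLaw x := by
  rw [← hπ.integral_interimPayment]
  exact integral_nonneg_of_ae (ae_payment_nonneg (M.density_measurable k.1) (M.cost_nonneg k.1)
    (interimAlloc_nonneg π x k) (hIR x k))

theorem meanShipped_eq_sum (x : State E) (l : Lane E) :
    M.meanShipped π x l = ∑ s : Fin (x.1 l), ∫ C, allocProb π x ⟨l, s⟩ C ∂M.profileLaw x := by
  have := hπ.lottery_markov x
  have := hπ.isProbabilityMeasure_outcomeLaw x
  simp only [meanShipped, shipped_eq_sum_indicator]
  rw [integral_finsetSum _ fun s _ => (integrable_const (1 : ℝ)).indicator .of_discrete]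
  refine Finset.sum_congr rfl fun s _ => ?_
  rw [integral_indicator_const _ .of_discrete, smul_eq_mul, mul_one]
  simp only [allocProb, Measure.real, outcomeLaw]
  rw [Measure.bind_apply .of_discrete (π.lottery x).aemeasurable,
    integral_toReal ((π.lottery x).measurable_coe .of_discrete).aemeasurable
      (ae_of_all _ fun C => measure_lt_top _ _)]

theorem meanPayment_eq_sum (x : State E) (l : Lane E) :
    M.meanPayment π x l = ∑ s : Fin (x.1 l), ∫ C, π.payment x ⟨l, s⟩ C ∂M.profileLaw x :=
  integral_finsetSum _ fun s _ => hπ.payment_integrable x ⟨l, s⟩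

theorem tangent_le_meanPayment (hIC : M.IsIC π) (hIR : M.IsIR π) (x : State E) (l : Lane E)
    {z : ℝ} (hz : 0 < M.density l z) :
    virtualCost (M.density l) z * (M.meanShipped π x l - M.F l z * x.1 l) + z * M.F l z * x.1 l
      ≤ M.meanPayment π x l := by
  rw [hπ.meanPayment_eq_sum, hπ.meanShipped_eq_sum]
  refine le_trans (le_of_eq ?_) (Finset.sum_le_sum fun (s : Fin (x.1 l)) _ =>
    hπ.tangent_le_integral_payment hIC hIR x ⟨l, s⟩ hz)
  simp only [Finset.sum_add_distrib, ← Finset.mul_sum, Finset.sum_sub_distrib, Finset.sum_const,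
    Finset.card_univ, Fintype.card_fin, nsmul_eq_mul]
  ring

theorem meanPayment_nonneg (hIR : M.IsIR π) (x : State E) (l : Lane E) :
    0 ≤ M.meanPayment π x l := by
  rw [hπ.meanPayment_eq_sum]
  exact Finset.sum_nonneg fun s _ => hπ.integral_payment_nonneg hIR x ⟨l, s⟩

theorem ae_shipped_le_loads (x : State E) (l : Lane E) :
    ∀ᵐ W ∂M.outcomeLaw π x, shipped W l ≤ x.2 l := by
  rw [ae_iff, outcomeLaw, Measure.bind_apply .of_discrete (π.lottery x).aemeasurable]
  exact lintegral_eq_zero_of_ae_eq_zero (ae_of_all _ fun C => ae_iff.1 (hπ.shipped_le x C l))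

theorem meanShipped_le_of_ae_shipped_le {x : State E} {l : Lane E} {n : ℕ}
    (h : ∀ᵐ W ∂M.outcomeLaw π x, shipped W l ≤ n) : M.meanShipped π x l ≤ n := by
  have := hπ.isProbabilityMeasure_outcomeLaw x
  refine (integral_mono_of_nonneg (ae_of_all _ fun _ => Nat.cast_nonneg _)
    (integrable_const (n : ℝ)) (h.mono fun W hW => Nat.cast_le.2 hW)).trans ?_
  simp

theorem meanShipped_le_supply (x : State E) (l : Lane E) : M.meanShipped π x l ≤ x.1 l :=
  hπ.meanShipped_le_of_ae_shipped_le (ae_of_all _ fun W => shipped_le_supply W l)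

theorem meanShipped_le_loads (x : State E) (l : Lane E) : M.meanShipped π x l ≤ x.2 l :=
  hπ.meanShipped_le_of_ae_shipped_le (hπ.ae_shipped_le_loads x l)

end IsPolicy

end Market

/-! ### Means of laws of counts -/

theorem lintegral_natCast_poissonMeasure (r : NNReal) :
    ∫⁻ n, (n : ENNReal) ∂poissonMeasure r = r := by
  have htotal : ∑' n : ℕ, poissonMeasure r {n} = 1 := by
    simpa using (lintegral_countable' (μ := poissonMeasure r) fun _ => 1).symm
  have hshift (n : ℕ) :
      ((n + 1 : ℕ) : ENNReal) * poissonMeasure r {n + 1} = r * poissonMeasure r {n} := by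
    rw [poissonMeasure_singleton, poissonMeasure_singleton, ← ENNReal.ofReal_natCast,
      ← ENNReal.ofReal_coe_nnreal, ← ENNReal.ofReal_mul (by positivity),
      ← ENNReal.ofReal_mul (by positivity), Nat.factorial_succ]
    congr 1
    push_cast
    field_simp
    ring
  rw [lintegral_countable', tsum_eq_zero_add' ENNReal.summable]
  simp only [hshift, ENNReal.tsum_mul_left, htotal, Nat.cast_zero, zero_mul, zero_add, mul_one]

section Bind

variable {α β : Type*} [MeasurableSpace α] [MeasurableSpace β] {μ : Measure α} {κ : α → Measure β}
  {f : β → ℕ} {g : α → ℝ}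

theorem lintegral_natCast_bind (hκ : Measurable κ) (hf : Measurable f) (hg : Integrable g μ)
    (hg0 : ∀ x, 0 ≤ g x) (h : ∀ x, ∫⁻ y, (f y : ENNReal) ∂κ x = ENNReal.ofReal (g x)) :
    ∫⁻ y, (f y : ENNReal) ∂μ.bind κ = ENNReal.ofReal (∫ x, g x ∂μ) := by
  have hf' : Measurable fun y => (f y : ENNReal) := measurable_from_top.comp hf
  rw [Measure.lintegral_bind hκ.aemeasurable hf'.aemeasurable,
    ofReal_integral_eq_lintegral_ofReal hg (ae_of_all _ hg0)]
  exact lintegral_congr h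

theorem integrable_natCast_bind (hκ : Measurable κ) (hf : Measurable f) (hg : Integrable g μ)
    (hg0 : ∀ x, 0 ≤ g x) (h : ∀ x, ∫⁻ y, (f y : ENNReal) ∂κ x = ENNReal.ofReal (g x)) :
    Integrable (fun y => (f y : ℝ)) (μ.bind κ) := by
  refine ⟨(measurable_from_top.comp hf).aestronglyMeasurable, ?_⟩
  rw [hasFiniteIntegral_iff_ofReal (ae_of_all _ fun _ => Nat.cast_nonneg _)]
  simp only [ENNReal.ofReal_natCast, lintegral_natCast_bind hκ hf hg hg0 h, ENNReal.ofReal_lt_top]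

theorem integral_natCast_bind (hκ : Measurable κ) (hf : Measurable f) (hg : Integrable g μ)
    (hg0 : ∀ x, 0 ≤ g x) (h : ∀ x, ∫⁻ y, (f y : ENNReal) ∂κ x = ENNReal.ofReal (g x)) :
    ∫ y, (f y : ℝ) ∂μ.bind κ = ∫ x, g x ∂μ := by
  rw [integral_eq_lintegral_of_nonneg_ae (ae_of_all _ fun _ => Nat.cast_nonneg _)
    (measurable_from_top.comp hf).aestronglyMeasurable]
  simp only [ENNReal.ofReal_natCast, lintegral_natCast_bind hκ hf hg hg0 h,
    ENNReal.toReal_ofReal (integral_nonneg hg0)]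

end Bind

/-! ### One transition of the chain -/

namespace Market

variable {N : Type*} {E : Finset (N × N)}

instance (rate : Lane E → ℝ) : IsProbabilityMeasure (poissonLaw rate) := by
  unfold poissonLaw; infer_instance

theorem lintegral_poissonLaw (rate : Lane E → ℝ) (l : Lane E) :
    ∫⁻ m, (m l : ENNReal) ∂poissonLaw rate = ENNReal.ofReal (rate l) :=
  ((measurePreserving_eval (fun l : Lane E => poissonMeasure (rate l).toNNReal) l).lintegral_comp
    (f := fun n : ℕ => (n : ENNReal)) .of_discrete).trans (lintegral_natCast_poissonMeasure _)

variable [DecidableEq N] (M : Market E) {π : Policy E}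

/-- The probability that a carrier who ships a load on lane `k` is available on lane `l` in the
next period. It vanishes unless `k` ends where `l` starts, so that the sums over predecessors of
the paper become sums over all lanes. -/
noncomputable def transfer (l k : Lane E) : ℝ := if k.1.2 = l.1.1 then M.stay l else 0

/-- The expected supply of lane `l` in the next period when the expected shipments are `y`; this
is the left-hand side of the flow constraint of the fluid program. -/
noncomputable def inflow (y : Lane E → ℝ) (l : Lane E) : ℝ :=
  ∑ k, M.transfer l k * y k + M.arrival l

/-- The law of `Z`, the carriers who stay, given the state. -/
noncomputable def relocationLaw (π : Policy E) (x : State E) : Measure (Lane E → ℕ) :=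
  (M.outcomeLaw π x).bind fun W => M.stayLaw (shipped W)

theorem transfer_nonneg (l k : Lane E) : 0 ≤ M.transfer l k := by
  unfold transfer
  split_ifs
  exacts [M.stay_nonneg l, le_rfl]

instance (j : N) : IsProbabilityMeasure (M.moveLaw j) := by
  have hnonneg (l : Lane E) : 0 ≤ if l.1.1 = j then M.stay l else 0 := by
    split_ifs
    exacts [M.stay_nonneg l, le_rfl]
  have hofReal (l : Lane E) : (if l.1.1 = j then ENNReal.ofReal (M.stay l) else 0) =
      ENNReal.ofReal (if l.1.1 = j then M.stay l else 0) := by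
    split_ifs <;> simp
  refine ⟨?_⟩
  simp only [moveLaw, Measure.add_apply, Measure.smul_apply, Measure.finsetSum_apply, measure_univ,
    smul_eq_mul, mul_one, hofReal]
  rw [← ENNReal.ofReal_sum_of_nonneg fun l _ => hnonneg l,
    ← ENNReal.ofReal_add (sub_nonneg.2 (M.stay_sum_le j)) (Finset.sum_nonneg fun l _ => hnonneg l),
    sub_add_cancel, ENNReal.ofReal_one]

instance (Y : Lane E → ℕ) : IsProbabilityMeasure (M.stayLaw Y) :=
  Measure.isProbabilityMeasure_map (Measurable.of_discrete).aemeasurable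

theorem lintegral_moveLaw (k l : Lane E) :
    ∫⁻ m, (m l : ENNReal) ∂M.moveLaw k.1.2 = ENNReal.ofReal (M.transfer l k) := by
  rw [moveLaw, lintegral_add_measure, lintegral_smul_measure, lintegral_finsetSum_measure,
    Finset.sum_eq_single (M := ENNReal) l]
  · rw [lintegral_smul_measure, lintegral_dirac' _ .of_discrete, lintegral_dirac' _ .of_discrete]
    simp [transfer, eq_comm, apply_ite ENNReal.ofReal]
  · intro i _ hi
    rw [lintegral_smul_measure, lintegral_dirac' _ .of_discrete]
    simp [Pi.single_eq_of_ne hi.symm]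
  · simp

theorem lintegral_stayLaw (Y : Lane E → ℕ) (l : Lane E) :
    ∫⁻ m, (m l : ENNReal) ∂M.stayLaw Y = ∑ k, ENNReal.ofReal (M.transfer l k) * Y k := by
  have hcarrier (k : Σ l : Lane E, Fin (Y l)) :
      ∫⁻ m, ((m k l : ℕ) : ENNReal)
        ∂Measure.pi (fun k : (Σ l : Lane E, Fin (Y l)) => M.moveLaw k.1.1.2) =
      ENNReal.ofReal (M.transfer l k.1) :=
    ((measurePreserving_eval (fun k : (Σ l : Lane E, Fin (Y l)) => M.moveLaw k.1.1.2)
      k).lintegral_comp (f := fun m : Lane E → ℕ => (m l : ENNReal)) .of_discrete).trans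
      (M.lintegral_moveLaw k.1 l)
  rw [stayLaw, lintegral_map .of_discrete .of_discrete]
  simp only [Finset.sum_apply, Nat.cast_sum]
  rw [lintegral_finsetSum _ fun _ _ => .of_discrete]
  simp only [hcarrier, Fintype.sum_sigma, Finset.sum_const, Finset.card_univ, Fintype.card_fin,
    nsmul_eq_mul, mul_comm]

variable {M}

theorem arrival_le_inflow {y : Lane E → ℝ} (hy : ∀ k, 0 ≤ y k) (l : Lane E) :
    M.arrival l ≤ M.inflow y l :=
  le_add_of_nonneg_left (Finset.sum_nonneg fun k _ => mul_nonneg (M.transfer_nonneg l k) (hy k))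

theorem inflow_pos {y : Lane E → ℝ} (hy : ∀ k, 0 ≤ y k) (l : Lane E) : 0 < M.inflow y l :=
  (M.arrival_pos l).trans_le (arrival_le_inflow hy l)

namespace IsPolicy

variable (hπ : M.IsPolicy π)

include hπ

theorem demand_nonneg (x : State E) (l : Lane E) : 0 ≤ M.demand l (π.price x l) :=
  M.demand_nonneg l _ (hπ.price_mem x l)

theorem lintegral_shipped (x : State E) (l : Lane E) :
    ∫⁻ W, (shipped W l : ENNReal) ∂M.outcomeLaw π x = ENNReal.ofReal (M.meanShipped π x l) := by
  have := hπ.isProbabilityMeasure_outcomeLaw x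
  rw [meanShipped, ofReal_integral_eq_lintegral_ofReal .of_finite
    (ae_of_all _ fun _ => Nat.cast_nonneg _)]
  simp only [ENNReal.ofReal_natCast]

theorem isProbabilityMeasure_relocationLaw (x : State E) :
    IsProbabilityMeasure (M.relocationLaw π x) :=
  have := hπ.isProbabilityMeasure_outcomeLaw x
  isProbabilityMeasure_bind (Measurable.of_discrete).aemeasurable
    (ae_of_all _ fun _ => inferInstance)

theorem lintegral_relocationLaw (x : State E) (l : Lane E) :
    ∫⁻ m, (m l : ENNReal) ∂M.relocationLaw π x =
      ENNReal.ofReal (∑ k, M.transfer l k * M.meanShipped π x k) := by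
  rw [relocationLaw, Measure.lintegral_bind (Measurable.of_discrete).aemeasurable
    (Measurable.of_discrete).aemeasurable, ENNReal.ofReal_sum_of_nonneg fun k _ =>
      mul_nonneg (M.transfer_nonneg l k) (meanShipped_nonneg π x k)]
  simp only [lintegral_stayLaw]
  rw [lintegral_finsetSum _ fun _ _ => .of_discrete]
  refine Finset.sum_congr rfl fun k _ => ?_
  rw [lintegral_const_mul _ .of_discrete, hπ.lintegral_shipped,
    ENNReal.ofReal_mul (M.transfer_nonneg l k)]

theorem isProbabilityMeasure_step (x : State E) : IsProbabilityMeasure (M.step π x) :=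
  have : IsProbabilityMeasure ((M.outcomeLaw π x).bind fun W => M.stayLaw (shipped W)) :=
    hπ.isProbabilityMeasure_relocationLaw x
  Measure.isProbabilityMeasure_map (Measurable.of_discrete).aemeasurable

theorem lintegral_step_supply (x : State E) (l : Lane E) :
    ∫⁻ x', (x'.1 l : ENNReal) ∂M.step π x =
      ENNReal.ofReal (M.inflow (M.meanShipped π x) l) := by
  have := hπ.isProbabilityMeasure_relocationLaw x
  rw [step, ← relocationLaw, lintegral_map .of_discrete .of_discrete,
    lintegral_prod _ (Measurable.of_discrete).aemeasurable, inflow,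
    ENNReal.ofReal_add (Finset.sum_nonneg fun k _ =>
      mul_nonneg (M.transfer_nonneg l k) (meanShipped_nonneg π x k)) (M.arrival_pos l).le,
    ← hπ.lintegral_relocationLaw, ← lintegral_poissonLaw]
  simp only [Pi.add_apply, Nat.cast_add]
  have harrival :
      ∫⁻ w, (w.1 l : ENNReal) ∂(poissonLaw M.arrival).prod
        (poissonLaw fun l => M.demand l (π.price x l)) =
      ∫⁻ m, (m l : ENNReal) ∂poissonLaw M.arrival :=
    measurePreserving_fst.lintegral_comp (f := fun m : Lane E → ℕ => (m l : ENNReal)) .of_discrete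
  simp only [lintegral_add_left Measurable.of_discrete, lintegral_const, measure_univ, mul_one,
    harrival]

theorem lintegral_step_loads (x : State E) (l : Lane E) :
    ∫⁻ x', (x'.2 l : ENNReal) ∂M.step π x = ENNReal.ofReal (M.demand l (π.price x l)) := by
  have := hπ.isProbabilityMeasure_relocationLaw x
  rw [step, ← relocationLaw, lintegral_map .of_discrete .of_discrete]
  exact ((measurePreserving_snd.comp measurePreserving_snd).lintegral_comp
    (f := fun m : Lane E → ℕ => (m l : ENNReal)) .of_discrete).trans (lintegral_poissonLaw _ l)

end IsPolicy

end Market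

/-! ### Averages of laws -/

theorem sum_div_sub_sum_div_eq_of_succ {a b : ℕ → ℝ} (h : ∀ t, a (t + 1) = b t) (T : ℕ) :
    (∑ t ∈ Finset.range T, a t) / T - (∑ t ∈ Finset.range T, b t) / T = (a 0 - a T) / T := by
  rw [← sub_div, ← Finset.sum_sub_distrib, ← Finset.sum_range_sub' a]
  simp only [h]

section AverageLaw

variable {α : Type*} [MeasurableSpace α] {μ : ℕ → Measure α} {T : ℕ}

/-- The average of the laws `μ 0, …, μ (T - 1)`; for the laws of a chain, its mean occupation law
over the first `T` periods. -/
noncomputable def averageLaw (μ : ℕ → Measure α) (T : ℕ) : Measure α :=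
  (T : ENNReal)⁻¹ • ∑ t ∈ Finset.range T, μ t

theorem isProbabilityMeasure_averageLaw [∀ t, IsProbabilityMeasure (μ t)] (hT : T ≠ 0) :
    IsProbabilityMeasure (averageLaw μ T) := by
  refine ⟨?_⟩
  simp only [averageLaw, Measure.smul_apply, Measure.finsetSum_apply, measure_univ,
    Finset.sum_const, Finset.card_range, nsmul_eq_mul, mul_one, smul_eq_mul]
  exact ENNReal.inv_mul_cancel (Nat.cast_ne_zero.2 hT) (ENNReal.natCast_ne_top T)

theorem integrable_averageLaw_iff {g : α → ℝ} (hT : T ≠ 0) :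
    Integrable g (averageLaw μ T) ↔ ∀ t < T, Integrable g (μ t) := by
  rw [averageLaw, integrable_smul_measure (ENNReal.inv_ne_zero.2 (ENNReal.natCast_ne_top T))
    (ENNReal.inv_ne_top.2 (Nat.cast_ne_zero.2 hT)), integrable_finsetSum_measure]
  simp only [Finset.mem_range]

theorem integral_averageLaw {g : α → ℝ} (hg : ∀ t < T, Integrable g (μ t)) :
    ∫ x, g x ∂averageLaw μ T = (∑ t ∈ Finset.range T, ∫ x, g x ∂μ t) / T := by
  rw [averageLaw, integral_smul_measure,
    integral_finsetSum_measure fun t ht => hg t (Finset.mem_range.1 ht),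
    ENNReal.toReal_inv, ENNReal.toReal_natCast, smul_eq_mul, div_eq_inv_mul]

theorem ae_of_ae_averageLaw {p : α → Prop} (h : ∀ᵐ x ∂averageLaw μ T, p x) {t : ℕ}
    (ht : t < T) : ∀ᵐ x ∂μ t, p x := by
  rw [ae_iff] at h ⊢
  simp only [averageLaw, Measure.smul_apply, smul_eq_mul, mul_eq_zero, ENNReal.inv_eq_zero,
    ENNReal.natCast_ne_top, false_or, Measure.finsetSum_apply, Finset.sum_eq_zero_iff] at h
  exact h t (Finset.mem_range.2 ht)

end AverageLaw

/-! ### Means and balance equations of the chain -/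

namespace Market

variable {N : Type*} {E : Finset (N × N)}

/-- Integrability of the supplies and the loads under a law of the state. -/
structure FiniteMeans (μ : Measure (State E)) : Prop where
  supply : ∀ l, Integrable (fun x : State E => (x.1 l : ℝ)) μ
  loads : ∀ l, Integrable (fun x : State E => (x.2 l : ℝ)) μ

/-- `E[S]` under a law of the state. -/
noncomputable def supplyMean (μ : Measure (State E)) (l : Lane E) : ℝ := ∫ x, (x.1 l : ℝ) ∂μ

/-- `E[D]` under a law of the state. -/
noncomputable def loadMean (μ : Measure (State E)) (l : Lane E) : ℝ := ∫ x, (x.2 l : ℝ) ∂μ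

theorem supplyMean_nonneg (μ : Measure (State E)) (l : Lane E) : 0 ≤ supplyMean μ l :=
  integral_nonneg fun _ => Nat.cast_nonneg _

theorem loadMean_nonneg (μ : Measure (State E)) (l : Lane E) : 0 ≤ loadMean μ l :=
  integral_nonneg fun _ => Nat.cast_nonneg _

variable [DecidableEq N] {M : Market E} {π : Policy E}

variable (M π) in
/-- The mean of the demand rates set by the policy, under a law of the state. -/
noncomputable def demandMean (μ : Measure (State E)) (l : Lane E) : ℝ :=
  ∫ x, M.demand l (π.price x l) ∂μ

variable (M π) in
/-- `E[Y]` under a law of the state. -/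
noncomputable def shippedMean (μ : Measure (State E)) (l : Lane E) : ℝ :=
  ∫ x, M.meanShipped π x l ∂μ

theorem shippedMean_nonneg (μ : Measure (State E)) (l : Lane E) : 0 ≤ M.shippedMean π μ l :=
  integral_nonneg fun x => meanShipped_nonneg π x l

theorem integrable_inflow {μ : Measure (State E)} [IsFiniteMeasure μ] {y : State E → Lane E → ℝ}
    (hy : ∀ k, Integrable (fun x => y x k) μ) (l : Lane E) :
    Integrable (fun x => M.inflow (y x) l) μ :=
  (integrable_finsetSum _ fun k _ => (hy k).const_mul _).add (integrable_const _)

theorem integral_inflow {μ : Measure (State E)} [IsProbabilityMeasure μ]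
    {y : State E → Lane E → ℝ} (hy : ∀ k, Integrable (fun x => y x k) μ) (l : Lane E) :
    ∫ x, M.inflow (y x) l ∂μ = M.inflow (fun k => ∫ x, y x k ∂μ) l := by
  unfold inflow
  rw [integral_add (integrable_finsetSum _ fun k _ => (hy k).const_mul _) (integrable_const _),
    integral_finsetSum _ fun k _ => (hy k).const_mul _]
  simp only [integral_const_mul, integral_const, probReal_univ, one_smul]

namespace IsPolicy

variable (hπ : M.IsPolicy π)

include hπ

theorem integrable_meanShipped {μ : Measure (State E)} (hμ : FiniteMeans μ) (l : Lane E) :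
    Integrable (fun x => M.meanShipped π x l) μ :=
  (hμ.supply l).mono' (Measurable.of_discrete).aestronglyMeasurable <| ae_of_all _ fun x =>
    (Real.norm_of_nonneg (meanShipped_nonneg π x l)).trans_le (hπ.meanShipped_le_supply x l)

theorem integrable_demand (μ : Measure (State E)) [IsFiniteMeasure μ] (l : Lane E) :
    Integrable (fun x => M.demand l (π.price x l)) μ := by
  obtain ⟨B, hB⟩ := hπ.demand_bounded
  exact .of_bound (Measurable.of_discrete).aestronglyMeasurable B <| ae_of_all _ fun x =>
    (Real.norm_of_nonneg (hπ.demand_nonneg x l)).trans_le (hB x l)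

section Bind

variable {μ : Measure (State E)} [IsProbabilityMeasure μ]

theorem finiteMeans_bind_step (hμ : FiniteMeans μ) : FiniteMeans (μ.bind (M.step π)) :=
  ⟨fun l => integrable_natCast_bind (f := fun x : State E => x.1 l) .of_discrete .of_discrete
      (integrable_inflow (hπ.integrable_meanShipped hμ) l)
      (fun x => (inflow_pos (meanShipped_nonneg π x) l).le) fun x => hπ.lintegral_step_supply x l,
    fun l => integrable_natCast_bind (f := fun x : State E => x.2 l) .of_discrete .of_discrete
      (hπ.integrable_demand μ l) (fun x => hπ.demand_nonneg x l) fun x =>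
      hπ.lintegral_step_loads x l⟩

theorem supplyMean_bind_step (hμ : FiniteMeans μ) (l : Lane E) :
    supplyMean (μ.bind (M.step π)) l = M.inflow (M.shippedMean π μ) l :=
  (integral_natCast_bind (f := fun x : State E => x.1 l) .of_discrete .of_discrete
    (integrable_inflow (hπ.integrable_meanShipped hμ) l)
    (fun x => (inflow_pos (meanShipped_nonneg π x) l).le)
    fun x => hπ.lintegral_step_supply x l).trans (integral_inflow (hπ.integrable_meanShipped hμ) l)

theorem loadMean_bind_step (l : Lane E) :
    loadMean (μ.bind (M.step π)) l = M.demandMean π μ l :=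
  integral_natCast_bind (f := fun x : State E => x.2 l) .of_discrete .of_discrete
    (hπ.integrable_demand μ l) (fun x => hπ.demand_nonneg x l) fun x => hπ.lintegral_step_loads x l

end Bind

variable (ν : Measure (State E)) [IsProbabilityMeasure ν]

theorem isProbabilityMeasure_stateLaw (t : ℕ) : IsProbabilityMeasure (M.stateLaw π ν t) := by
  induction t with
  | zero => assumption
  | succ t ih =>
    exact isProbabilityMeasure_bind (Measurable.of_discrete).aemeasurable
      (ae_of_all _ fun x => hπ.isProbabilityMeasure_step x)

variable {ν}

theorem finiteMeans_stateLaw (hν : FiniteMeans ν) (t : ℕ) : FiniteMeans (M.stateLaw π ν t) := by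
  induction t with
  | zero => exact hν
  | succ t ih =>
    have := hπ.isProbabilityMeasure_stateLaw ν t
    exact hπ.finiteMeans_bind_step ih

theorem loadMean_stateLaw_le {l : Lane E} {K : ℝ} (hνK : loadMean ν l ≤ K)
    (hK : ∀ x, M.demand l (π.price x l) ≤ K) (t : ℕ) :
    loadMean (M.stateLaw π ν t) l ≤ K := by
  cases t with
  | zero => exact hνK
  | succ t =>
    have := hπ.isProbabilityMeasure_stateLaw ν t
    refine (hπ.loadMean_bind_step l).trans_le ?_
    refine (integral_mono (hπ.integrable_demand _ l) (integrable_const K) hK).trans ?_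
    simp

variable {T : ℕ}

theorem finiteMeans_averageLaw (hν : FiniteMeans ν) (hT : T ≠ 0) :
    FiniteMeans (averageLaw (M.stateLaw π ν) T) :=
  ⟨fun l => (integrable_averageLaw_iff hT).2 fun t _ => (hπ.finiteMeans_stateLaw hν t).supply l,
    fun l => (integrable_averageLaw_iff hT).2 fun t _ => (hπ.finiteMeans_stateLaw hν t).loads l⟩

theorem loadMean_averageLaw_le (hν : FiniteMeans ν) (hT : T ≠ 0) {l : Lane E} {K : ℝ}
    (hνK : loadMean ν l ≤ K) (hK : ∀ x, M.demand l (π.price x l) ≤ K) :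
    loadMean (averageLaw (M.stateLaw π ν) T) l ≤ K := by
  rw [loadMean, integral_averageLaw fun t _ => (hπ.finiteMeans_stateLaw hν t).loads l,
    div_le_iff₀ (Nat.cast_pos.2 (Nat.pos_of_ne_zero hT))]
  calc ∑ t ∈ Finset.range T, ∫ x, (x.2 l : ℝ) ∂M.stateLaw π ν t
      ≤ ∑ _t ∈ Finset.range T, K :=
        Finset.sum_le_sum fun t _ => hπ.loadMean_stateLaw_le hνK hK t
    _ = K * T := by rw [Finset.sum_const, Finset.card_range, nsmul_eq_mul, mul_comm]

theorem supplyMean_averageLaw_sub_inflow (hν : FiniteMeans ν) (hT : T ≠ 0) (l : Lane E) :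
    supplyMean (averageLaw (M.stateLaw π ν) T) l -
        M.inflow (M.shippedMean π (averageLaw (M.stateLaw π ν) T)) l =
      (supplyMean ν l - supplyMean (M.stateLaw π ν T) l) / T := by
  have hprob := hπ.isProbabilityMeasure_stateLaw ν
  have := isProbabilityMeasure_averageLaw (μ := M.stateLaw π ν) hT
  have hfin := hπ.finiteMeans_stateLaw hν
  have hflow : M.inflow (M.shippedMean π (averageLaw (M.stateLaw π ν) T)) l =
      (∑ t ∈ Finset.range T, M.inflow (M.shippedMean π (M.stateLaw π ν t)) l) / T := by
    refine (integral_inflow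
      (hπ.integrable_meanShipped (hπ.finiteMeans_averageLaw hν hT)) l).symm.trans ?_
    rw [integral_averageLaw fun t _ => integrable_inflow (hπ.integrable_meanShipped (hfin t)) l]
    simp only [integral_inflow (hπ.integrable_meanShipped (hfin _))]
    rfl
  rw [hflow, supplyMean, integral_averageLaw fun t _ => (hfin t).supply l]
  exact sum_div_sub_sum_div_eq_of_succ (a := fun t => supplyMean (M.stateLaw π ν t) l)
    (fun t => hπ.supplyMean_bind_step (hfin t) l) T

theorem loadMean_averageLaw_sub_demandMean (hν : FiniteMeans ν) (l : Lane E) :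
    loadMean (averageLaw (M.stateLaw π ν) T) l - M.demandMean π (averageLaw (M.stateLaw π ν) T) l =
      (loadMean ν l - loadMean (M.stateLaw π ν T) l) / T := by
  have hprob := hπ.isProbabilityMeasure_stateLaw ν
  rw [loadMean, demandMean,
    integral_averageLaw fun t _ => (hπ.finiteMeans_stateLaw hν t).loads l,
    integral_averageLaw fun t _ => hπ.integrable_demand _ l]
  exact sum_div_sub_sum_div_eq_of_succ (a := fun t => loadMean (M.stateLaw π ν t) l)
    (fun t => hπ.loadMean_bind_step l) T

end IsPolicy

end Market

/-! ### Affine majorants of concave functions at a mean -/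

theorem exists_supporting_line {D : Set ℝ} {R : ℝ → ℝ} (hR : ConcaveOn ℝ D R) {x : ℝ}
    (hx : x ∈ interior D) : ∃ m : ℝ, ∀ d ∈ D, R d ≤ R x + m * (d - x) := by
  have hconvex : ConvexOn ℝ D (-R) := hR.neg
  refine ⟨-derivWithin (-R) (Ioi x) x, fun d hd => ?_⟩
  rcases lt_trichotomy d x with hlt | rfl | hlt
  · have hslope := (hconvex.slope_le_leftDeriv_of_mem_interior hd hx hlt).trans
      (hconvex.leftDeriv_le_rightDeriv_of_mem_interior hx)
    rw [slope_def_field, div_le_iff₀ (sub_pos.2 hlt)] at hslope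
    simp only [Pi.neg_apply] at hslope
    linarith
  · simp
  · have hslope := hconvex.rightDeriv_le_slope_of_mem_interior hx hd hlt
    rw [slope_def_field, le_div_iff₀ (sub_pos.2 hlt)] at hslope
    simp only [Pi.neg_apply] at hslope
    linarith

section Mean

variable {α : Type*} [MeasurableSpace α] {μ : Measure α} [IsProbabilityMeasure μ] {X : α → ℝ}
  {D : Set ℝ} {R : ℝ → ℝ}

theorem integral_mem_of_ordConnected (hD : D.OrdConnected) (hX : Integrable X μ)
    (hXD : ∀ x, X x ∈ D) : ∫ x, X x ∂μ ∈ D := by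
  obtain ⟨p, hp⟩ := exists_le_integral hX
  obtain ⟨q, hq⟩ := exists_integral_le hX
  exact hD.out (hXD p) (hXD q) ⟨hp, hq⟩

theorem ae_eq_integral_or_integral_mem_interior (hD : D.OrdConnected) (hX : Integrable X μ)
    (hXD : ∀ x, X x ∈ D) : (X =ᵐ[μ] fun _ => ∫ x, X x ∂μ) ∨ ∫ x, X x ∂μ ∈ interior D := by
  have hconst : ∫ _, (∫ x, X x ∂μ) ∂μ = ∫ x, X x ∂μ := by simp
  by_cases hlower : ∀ x, ∫ x, X x ∂μ ≤ X x
  · exact .inl ((integral_eq_iff_of_ae_le (integrable_const _) hX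
      (ae_of_all _ hlower)).1 hconst).symm
  by_cases hupper : ∀ x, X x ≤ ∫ x, X x ∂μ
  · exact .inl ((integral_eq_iff_of_ae_le hX (integrable_const _)
      (ae_of_all _ hupper)).1 hconst.symm)
  push Not at hlower hupper
  obtain ⟨p, hp⟩ := hlower
  obtain ⟨q, hq⟩ := hupper
  exact .inr (mem_interior.2 ⟨Ioo (X p) (X q), Ioo_subset_Icc_self.trans (hD.out (hXD p) (hXD q)),
    isOpen_Ioo, hp, hq⟩)

/- Jensen's inequality in the form of a majorant: `R ∘ X` itself need not be measurable. -/
theorem exists_integrable_majorant_of_concaveOn (hR : ConcaveOn ℝ D R) (hX : Integrable X μ)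
    (hXD : ∀ x, X x ∈ D) :
    ∃ g, Integrable g μ ∧ (∀ᵐ x ∂μ, R (X x) ≤ g x) ∧ ∫ x, g x ∂μ = R (∫ x, X x ∂μ) := by
  rcases ae_eq_integral_or_integral_mem_interior hR.1.ordConnected hX hXD with hconst | hint
  · exact ⟨fun _ => R (∫ x, X x ∂μ), integrable_const _, hconst.mono fun x hx => by rw [hx],
      by simp⟩
  obtain ⟨m, hm⟩ := exists_supporting_line hR hint
  have hdev : Integrable (fun x => X x - ∫ x, X x ∂μ) μ := hX.sub (integrable_const _)
  refine ⟨fun x => R (∫ x, X x ∂μ) + m * (X x - ∫ x, X x ∂μ),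
    (integrable_const _).add (hdev.const_mul m), ae_of_all _ fun x => hm _ (hXD x), ?_⟩
  rw [integral_add (integrable_const _) (hdev.const_mul m), integral_const_mul,
    integral_sub hX (integrable_const _)]
  simp

end Mean

/-! ### Expectations in the extended reals -/

theorem coe_finsetSum_ereal {ι : Type*} (s : Finset ι) (f : ι → ℝ) :
    ((∑ i ∈ s, f i : ℝ) : EReal) = ∑ i ∈ s, (f i : EReal) :=
  map_sum (⟨⟨Real.toEReal, EReal.coe_zero⟩, EReal.coe_add⟩ : ℝ →+ EReal) f s

theorem limsup_le_of_eventually_le_add_div {u : ℕ → EReal} {v : EReal} {c : ℝ}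
    (h : ∀ᶠ T : ℕ in atTop, u T ≤ v + ((c / T : ℝ) : EReal)) : limsup u atTop ≤ v := by
  have herror : Tendsto (fun T : ℕ => ((c / T : ℝ) : EReal)) atTop (nhds 0) :=
    (continuous_coe_real_ereal.tendsto 0).comp (tendsto_const_div_atTop_nhds_zero_nat c)
  have hlim : Tendsto (fun T : ℕ => v + ((c / T : ℝ) : EReal)) atTop (nhds (v + 0)) :=
    (EReal.continuousAt_add (.inr EReal.zero_ne_bot) (.inr EReal.zero_ne_top)).tendsto.comp
      (tendsto_const_nhds.prodMk_nhds herror)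
  rw [← add_zero v, ← hlim.limsup_eq]
  exact limsup_le_limsup h

section ExtExpectation

variable {α : Type*} [MeasurableSpace α] {f g : α → ℝ}

theorem extExpectation_le {μ : Measure α} (hg : Integrable g μ) (hfg : ∀ᵐ x ∂μ, f x ≤ g x) :
    Market.extExpectation μ f ≤ ((∫ x, g x ∂μ : ℝ) : EReal) := by
  have hpos : ∫⁻ x, ENNReal.ofReal (g x) ∂μ ≠ ⊤ := hg.lintegral_lt_top.ne
  have hneg : ∫⁻ x, ENNReal.ofReal (-g x) ∂μ ≠ ⊤ := hg.neg.lintegral_lt_top.ne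
  rw [integral_eq_lintegral_pos_part_sub_lintegral_neg_part hg, EReal.coe_sub,
    EReal.coe_ennreal_toReal hpos, EReal.coe_ennreal_toReal hneg]
  exact EReal.sub_le_sub
    (EReal.coe_ennreal_le_coe_ennreal_iff.2
      (lintegral_mono_ae (hfg.mono fun x hx => ENNReal.ofReal_le_ofReal hx)))
    (EReal.coe_ennreal_le_coe_ennreal_iff.2
      (lintegral_mono_ae (hfg.mono fun x hx => ENNReal.ofReal_le_ofReal (neg_le_neg hx))))

theorem sum_extExpectation_div_le {μ : ℕ → Measure α} {T : ℕ} (hT : T ≠ 0)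
    (hg : Integrable g (averageLaw μ T)) (hfg : ∀ᵐ x ∂averageLaw μ T, f x ≤ g x) :
    (∑ t ∈ Finset.range T, Market.extExpectation (μ t) f) / ((T : ℝ) : EReal) ≤
      ((∫ x, g x ∂averageLaw μ T : ℝ) : EReal) := by
  have hgt := (integrable_averageLaw_iff hT).1 hg
  rw [integral_averageLaw hgt, EReal.coe_div, coe_finsetSum_ereal]
  refine EReal.div_le_div_right_of_nonneg (EReal.coe_nonneg.2 T.cast_nonneg) ?_
  exact Finset.sum_le_sum fun t ht => extExpectation_le (hgt t (Finset.mem_range.1 ht))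
    (ae_of_ae_averageLaw hfg (Finset.mem_range.1 ht))

end ExtExpectation

namespace Market

variable {N : Type*} {E : Finset (N × N)}

/-! ### Feasible points of the fluid program near approximately feasible ones -/

/-- The shipments `y`, cut down to the demand rates `d` and scaled down by `1 - ε`. -/
def shrink (ε : ℝ) (d y : Lane E → ℝ) (l : Lane E) : ℝ := (1 - ε) * min (y l) (d l)

theorem shrink_le_mul {ε : ℝ} (hε : ε ≤ 1) (d y : Lane E → ℝ) (l : Lane E) :
    shrink ε d y l ≤ (1 - ε) * y l :=
  mul_le_mul_of_nonneg_left (min_le_left _ _) (sub_nonneg.2 hε)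

variable [DecidableEq N] (M : Market E)

/-- Supplies `S`, loads `D`, demand rates `d` and shipments `y` that satisfy the constraints of the
fluid program with `S` in place of `lam`, except that the loads match the demand rates and the
supplies the flow constraint only up to `δ`. -/
structure IsApproxFeasible (δ : ℝ) (S D d y : Lane E → ℝ) : Prop where
  shipped_nonneg : ∀ l, 0 ≤ y l
  shipped_le_supply : ∀ l, y l ≤ S l
  shipped_le_loads : ∀ l, y l ≤ D l
  loads_near_demand : ∀ l, |D l - d l| ≤ δ
  supply_le_inflow : ∀ l, S l ≤ M.inflow y l + δ
  demand_mem : ∀ l, d l ∈ M.demand l '' M.prices l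

/-- The scale `ε / δ` of the reduction of the shipments which turns a point that is feasible up to
`δ` into a feasible one. -/
noncomputable def reduction : ℝ := 1 + ∑ l, (1 + ∑ k, M.transfer l k) / M.arrival l

variable {M}

theorem one_add_sum_transfer_pos (l : Lane E) : 0 < 1 + ∑ k, M.transfer l k :=
  add_pos_of_pos_of_nonneg one_pos (Finset.sum_nonneg fun k _ => M.transfer_nonneg l k)

theorem one_add_sum_transfer_lt (l : Lane E) :
    1 + ∑ k, M.transfer l k < M.reduction * M.arrival l := by
  rw [← div_lt_iff₀ (M.arrival_pos l)]
  refine lt_of_le_of_lt ?_ (lt_one_add _)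
  exact Finset.single_le_sum (f := fun l => (1 + ∑ k, M.transfer l k) / M.arrival l)
    (fun k _ => (div_pos (one_add_sum_transfer_pos k) (M.arrival_pos k)).le) (Finset.mem_univ l)

theorem reduction_pos : 0 < M.reduction :=
  add_pos_of_pos_of_nonneg one_pos <| Finset.sum_nonneg fun l _ =>
    (div_pos (one_add_sum_transfer_pos l) (M.arrival_pos l)).le

theorem mul_inflow_sub_le_inflow {y y' : Lane E → ℝ} {θ δ : ℝ}
    (h : ∀ k, θ * (y k - δ) ≤ y' k) (l : Lane E) :
    θ * (M.inflow y l - δ * ∑ k, M.transfer l k) + (1 - θ) * M.arrival l ≤ M.inflow y' l := by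
  calc θ * (M.inflow y l - δ * ∑ k, M.transfer l k) + (1 - θ) * M.arrival l
      = M.inflow (fun k => θ * (y k - δ)) l := by
        simp only [inflow, mul_sub, Finset.sum_sub_distrib, mul_left_comm _ θ, ← Finset.mul_sum,
          ← Finset.sum_mul]
        ring
    _ ≤ M.inflow y' l := by
        unfold inflow
        gcongr with k
        exacts [M.transfer_nonneg l k, h k]

namespace IsApproxFeasible

variable {δ ε : ℝ} {S D d y : Lane E → ℝ} (h : M.IsApproxFeasible δ S D d y)

include h

theorem demand_nonneg (l : Lane E) : 0 ≤ d l := by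
  obtain ⟨r, hr, hrd⟩ := h.demand_mem l
  exact hrd ▸ M.demand_nonneg l r hr

theorem error_nonneg (l : Lane E) : 0 ≤ δ := (abs_nonneg _).trans (h.loads_near_demand l)

theorem mul_sub_le_shrink (hε : ε ≤ 1) (l : Lane E) : (1 - ε) * (y l - δ) ≤ shrink ε d y l := by
  have hclose := (abs_le.1 (h.loads_near_demand l)).2
  refine mul_le_mul_of_nonneg_left (le_min ?_ ?_) (sub_nonneg.2 hε)
  · linarith [h.error_nonneg l]
  · linarith [h.shipped_le_loads l]

theorem shrink_nonneg (hε : ε ≤ 1) (l : Lane E) : 0 ≤ shrink ε d y l :=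
  mul_nonneg (sub_nonneg.2 hε) (le_min (h.shipped_nonneg l) (h.demand_nonneg l))

theorem shrink_le_shipped (hε0 : 0 ≤ ε) (hε1 : ε ≤ 1) (l : Lane E) : shrink ε d y l ≤ y l :=
  (shrink_le_mul hε1 d y l).trans
    (mul_le_of_le_one_left (h.shipped_nonneg l) (sub_le_self 1 hε0))

/- Fewer shipments lower the inflow, but only by the same factor, and the arrivals are not scaled
at all: this leaves room for the error in the flow constraint. -/
theorem mul_supply_lt_inflow_shrink (hε0 : 0 ≤ ε) (hε1 : ε ≤ 1) {l : Lane E}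
    (hδε : δ * (1 + ∑ k, M.transfer l k) < ε * M.arrival l) :
    (1 - ε) * S l < M.inflow (shrink ε d y) l := by
  refine lt_of_lt_of_le ?_ (mul_inflow_sub_le_inflow (h.mul_sub_le_shrink hε1) l)
  have hsupply := mul_le_mul_of_nonneg_left (h.supply_le_inflow l) (sub_nonneg.2 hε1)
  have hslack : 0 ≤ ε * (δ * (1 + ∑ k, M.transfer l k)) :=
    mul_nonneg hε0 (mul_nonneg (h.error_nonneg l) (one_add_sum_transfer_pos l).le)
  linarith

theorem shrink_lt_inflow (hε1 : ε ≤ 1) {l : Lane E}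
    (hlt : (1 - ε) * S l < M.inflow (shrink ε d y) l) :
    shrink ε d y l < M.inflow (shrink ε d y) l :=
  ((shrink_le_mul hε1 d y l).trans
    (mul_le_mul_of_nonneg_left (h.shipped_le_supply l) (sub_nonneg.2 hε1))).trans_lt hlt

theorem faFeasible_shrink (hε0 : 0 ≤ ε) (hε1 : ε ≤ 1)
    (hlt : ∀ l, (1 - ε) * S l < M.inflow (shrink ε d y) l) :
    M.FAFeasible d (shrink ε d y) (M.inflow (shrink ε d y)) := by
  have hpos := inflow_pos (M := M) (h.shrink_nonneg hε1)
  exact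
    { flow := fun l => by simp only [inflow, transfer, ite_mul, zero_mul]
      y_le_d := fun l => (mul_le_of_le_one_left (le_min (h.shipped_nonneg l) (h.demand_nonneg l))
        (sub_le_self 1 hε0)).trans (min_le_right _ _)
      y_le_lam := fun l => (h.shrink_lt_inflow hε1 (hlt l)).le
      y_nonneg := h.shrink_nonneg hε1
      lam_nonneg := fun l => (hpos l).le
      d_nonneg := h.demand_nonneg
      d_mem := h.demand_mem
      ratio_mem := fun l => mem_range_distFun (M.density_measurable l) (M.cost_nonneg l)
        ⟨div_nonneg (h.shrink_nonneg hε1 l) (hpos l).le,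
          (div_lt_one (hpos l)).2 (h.shrink_lt_inflow hε1 (hlt l))⟩ }

theorem abs_unserved_sub_le (hε0 : 0 ≤ ε) (hε1 : ε ≤ 1) (l : Lane E) :
    |(d l - shrink ε d y l) - (D l - y l)| ≤ 2 * δ + ε * y l := by
  have hloads := abs_le.1 (h.loads_near_demand l)
  have hlower := h.mul_sub_le_shrink hε1 l
  have hupper := h.shrink_le_shipped hε0 hε1 l
  have hεδ := mul_nonneg hε0 (h.error_nonneg l)
  exact abs_le.2 ⟨by linarith, by linarith⟩

end IsApproxFeasible

end Market

namespace Market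

variable {N : Type*} {E : Finset (N × N)} [DecidableEq N] {M : Market E} {π : Policy E}

/-! ### The mean profit against the fluid objective -/

theorem faObjective_le_faValue {d y lam : Lane E → ℝ} (h : M.FAFeasible d y lam) :
    (M.FAObjective d y lam : EReal) ≤ M.FAValue :=
  le_sSup ⟨d, y, lam, h, rfl⟩

namespace IsPolicy

variable (hπ : M.IsPolicy π) {μ : Measure (State E)}

include hπ

theorem invDemand_demand_price (x : State E) (l : Lane E) :
    M.invDemand l (M.demand l (π.price x l)) = π.price x l :=
  (M.demand_strictAnti l).injOn.leftInvOn_invFunOn (hπ.price_mem x l)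

theorem demandMean_mem [IsProbabilityMeasure μ] (l : Lane E) :
    M.demandMean π μ l ∈ M.demand l '' M.prices l :=
  integral_mem_of_ordConnected (M.revenue_concave l).1.ordConnected (hπ.integrable_demand μ l)
    fun x => mem_image_of_mem _ (hπ.price_mem x l)

theorem exists_integrable_revenue_le [IsProbabilityMeasure μ] (l : Lane E) :
    ∃ g, Integrable g μ ∧ (∀ᵐ x ∂μ, π.price x l * M.demand l (π.price x l) ≤ g x) ∧
      ∫ x, g x ∂μ = M.invDemand l (M.demandMean π μ l) * M.demandMean π μ l := by
  obtain ⟨g, hg, hle, hint⟩ := exists_integrable_majorant_of_concaveOn (M.revenue_concave l)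
    (hπ.integrable_demand μ l) fun x => mem_image_of_mem _ (hπ.price_mem x l)
  refine ⟨g, hg, hle.mono fun x hx => ?_, hint⟩
  rwa [← invDemand, hπ.invDemand_demand_price x l] at hx

theorem exists_integrable_le_meanPayment (hIC : M.IsIC π) (hIR : M.IsIR π) (hμ : FiniteMeans μ)
    {l : Lane E} {y s : ℝ} (hy0 : 0 ≤ y) (hy : y ≤ M.shippedMean π μ l) (hys : y < s)
    (hratio : y * supplyMean μ l ≤ M.shippedMean π μ l * s) :
    ∃ q, Integrable q μ ∧ (∀ x, q x ≤ M.meanPayment π x l) ∧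
      M.invF l (y / s) * y ≤ ∫ x, q x ∂μ := by
  rcases hy0.eq_or_lt with rfl | hpos
  · exact ⟨0, integrable_zero _ _ _, fun x => hπ.meanPayment_nonneg hIR x l, by simp⟩
  have hs : 0 < s := hpos.trans hys
  have hu : y / s ∈ Ioo (0 : ℝ) 1 := ⟨div_pos hpos hs, (div_lt_one hs).2 hys⟩
  set z := M.invF l (y / s)
  have hFz : M.F l z = y / s := distFun_invDistFun hu
  have hz : 0 < M.density l z :=
    pos_of_distFun_mem_Ioo (M.density_measurable l) (M.density_interval l)
      (mem_of_eq_of_mem hFz hu)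
  have hY := hπ.integrable_meanShipped hμ l
  have hS := (hμ.supply l).const_mul (M.F l z)
  have hYS : Integrable (fun x => M.meanShipped π x l - M.F l z * x.1 l) μ := hY.sub hS
  have hzS := (hμ.supply l).const_mul (z * M.F l z)
  refine ⟨fun x => virtualCost (M.density l) z * (M.meanShipped π x l - M.F l z * x.1 l) +
    z * M.F l z * x.1 l, (hYS.const_mul _).add hzS,
    fun x => hπ.tangent_le_meanPayment hIC hIR x l hz, ?_⟩
  have hunmatched : 0 ≤ M.shippedMean π μ l - M.F l z * supplyMean μ l := by
    rw [hFz, div_mul_eq_mul_div, sub_nonneg, div_le_iff₀ hs]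
    exact hratio
  calc z * y ≤ z * M.shippedMean π μ l := mul_le_mul_of_nonneg_left hy (M.cost_nonneg l z hz)
    _ = z * (M.shippedMean π μ l - M.F l z * supplyMean μ l) + z * M.F l z * supplyMean μ l := by
      ring
    _ ≤ virtualCost (M.density l) z * (M.shippedMean π μ l - M.F l z * supplyMean μ l) +
        z * M.F l z * supplyMean μ l := by
      gcongr
      exact self_le_virtualCost hz
    _ = _ := by
      rw [integral_add (hYS.const_mul _) hzS, integral_const_mul, integral_const_mul,
        integral_sub hY hS, integral_const_mul]
      rfl

theorem integrable_unserved (hμ : FiniteMeans μ) (l : Lane E) :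
    Integrable (fun x => (x.2 l : ℝ) - M.meanShipped π x l) μ :=
  (hμ.loads l).sub (hπ.integrable_meanShipped hμ l)

theorem integral_unserved (hμ : FiniteMeans μ) (l : Lane E) :
    ∫ x, ((x.2 l : ℝ) - M.meanShipped π x l) ∂μ = loadMean μ l - M.shippedMean π μ l :=
  integral_sub (hμ.loads l) (hπ.integrable_meanShipped hμ l)

theorem exists_integrable_profit_le [IsProbabilityMeasure μ] (hIC : M.IsIC π) (hIR : M.IsIR π)
    (hμ : FiniteMeans μ) {y s : Lane E → ℝ} (hy0 : ∀ l, 0 ≤ y l)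
    (hy : ∀ l, y l ≤ M.shippedMean π μ l) (hys : ∀ l, y l < s l)
    (hratio : ∀ l, y l * supplyMean μ l ≤ M.shippedMean π μ l * s l) :
    ∃ g, Integrable g μ ∧ (∀ᵐ x ∂μ, M.profit π x ≤ g x) ∧
      ∫ x, g x ∂μ ≤ M.FAObjective (M.demandMean π μ) y s + ∑ l, |M.penalty l| *
        |(M.demandMean π μ l - y l) - (loadMean μ l - M.shippedMean π μ l)| := by
  choose r hr hr_le hr_int using fun l => hπ.exists_integrable_revenue_le (μ := μ) l
  choose q hq hq_le hq_int using fun l =>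
    hπ.exists_integrable_le_meanPayment hIC hIR hμ (hy0 l) (hy l) (hys l) (hratio l)
  have hb := fun l => (hπ.integrable_unserved hμ l).const_mul (M.penalty l)
  have hrb : ∀ l, Integrable
      (fun x => r l x - M.penalty l * (x.2 l - M.meanShipped π x l)) μ :=
    fun l => (hr l).sub (hb l)
  refine ⟨_, integrable_finsetSum Finset.univ fun l _ => (hrb l).sub (hq l), ?_, ?_⟩
  · filter_upwards [ae_all_iff.2 hr_le] with x hx
    exact Finset.sum_le_sum fun l _ => sub_le_sub (sub_le_sub_right (hx l) _) (hq_le l x)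
  rw [integral_finsetSum _ fun l _ => (hrb l).sub (hq l), FAObjective,
    ← Finset.sum_add_distrib]
  refine Finset.sum_le_sum fun l _ => ?_
  rw [integral_sub' (hrb l) (hq l), integral_sub (hr l) (hb l), integral_const_mul,
    hr_int l, hπ.integral_unserved hμ l, ← abs_mul]
  have hpenalty := le_abs_self
    (M.penalty l * ((M.demandMean π μ l - y l) - (loadMean μ l - M.shippedMean π μ l)))
  linarith [hq_int l]

theorem exists_integrable_profit_le_faValue_add [IsProbabilityMeasure μ] (hIC : M.IsIC π)
    (hIR : M.IsIR π) (hμ : FiniteMeans μ) {δ K : ℝ} (hδ : 0 < δ) (hδ1 : M.reduction * δ ≤ 1)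
    (h : M.IsApproxFeasible δ (supplyMean μ) (loadMean μ) (M.demandMean π μ) (M.shippedMean π μ))
    (hK : ∀ l, M.shippedMean π μ l ≤ K) :
    ∃ g, Integrable g μ ∧ (∀ᵐ x ∂μ, M.profit π x ≤ g x) ∧ ((∫ x, g x ∂μ : ℝ) : EReal) ≤
      M.FAValue + (((∑ l, |M.penalty l|) * (2 + M.reduction * K) * δ : ℝ) : EReal) := by
  set ε := M.reduction * δ
  have hε0 : 0 ≤ ε := (mul_pos reduction_pos hδ).le
  set y := shrink ε (M.demandMean π μ) (M.shippedMean π μ)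
  have hlt : ∀ l, (1 - ε) * supplyMean μ l < M.inflow y l := fun l =>
    h.mul_supply_lt_inflow_shrink hε0 hδ1 <| by
      linarith [mul_lt_mul_of_pos_left (one_add_sum_transfer_lt (M := M) l) hδ]
  have hratio : ∀ l, y l * supplyMean μ l ≤ M.shippedMean π μ l * M.inflow y l := fun l =>
    calc y l * supplyMean μ l
        ≤ (1 - ε) * M.shippedMean π μ l * supplyMean μ l :=
          mul_le_mul_of_nonneg_right (shrink_le_mul hδ1 _ _ l) (supplyMean_nonneg μ l)
      _ = M.shippedMean π μ l * ((1 - ε) * supplyMean μ l) := by ring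
      _ ≤ M.shippedMean π μ l * M.inflow y l :=
          mul_le_mul_of_nonneg_left (hlt l).le (h.shipped_nonneg l)
  obtain ⟨g, hg, hle, hint⟩ := hπ.exists_integrable_profit_le hIC hIR hμ (h.shrink_nonneg hδ1)
    (h.shrink_le_shipped hε0 hδ1) (fun l => h.shrink_lt_inflow hδ1 (hlt l)) hratio
  have herror : ∑ l, |M.penalty l| *
      |(M.demandMean π μ l - y l) - (loadMean μ l - M.shippedMean π μ l)| ≤
      (∑ l, |M.penalty l|) * (2 + M.reduction * K) * δ := by
    rw [mul_assoc, Finset.sum_mul]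
    gcongr with l
    refine (h.abs_unserved_sub_le hε0 hδ1 l).trans ?_
    linarith [mul_le_mul_of_nonneg_left (hK l) hε0]
  refine ⟨g, hg, hle, (EReal.coe_le_coe_iff.2 (hint.trans (add_le_add_right herror _))).trans ?_⟩
  rw [EReal.coe_add]
  exact add_le_add_left (faObjective_le_faValue (h.faFeasible_shrink hε0 hδ1 hlt)) _

end IsPolicy

end Market

namespace Market

/-! ### The long-run average profit -/

namespace IsPolicy

variable {N : Type*} {E : Finset (N × N)} [DecidableEq N] {M : Market E} {π : Policy E}
  (hπ : M.IsPolicy π)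

include hπ

theorem shippedMean_le_supplyMean {μ : Measure (State E)} (hμ : FiniteMeans μ) (l : Lane E) :
    M.shippedMean π μ l ≤ supplyMean μ l :=
  integral_mono (hπ.integrable_meanShipped hμ l) (hμ.supply l) (hπ.meanShipped_le_supply · l)

theorem shippedMean_le_loadMean {μ : Measure (State E)} (hμ : FiniteMeans μ) (l : Lane E) :
    M.shippedMean π μ l ≤ loadMean μ l :=
  integral_mono (hπ.integrable_meanShipped hμ l) (hμ.loads l) (hπ.meanShipped_le_loads · l)

theorem exists_pos_bound (ν : Measure (State E)) :
    ∃ K > 0, (∀ l, supplyMean ν l ≤ K) ∧ (∀ l, loadMean ν l ≤ K) ∧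
      ∀ x l, M.demand l (π.price x l) ≤ K := by
  obtain ⟨B, hB⟩ := hπ.demand_bounded
  obtain ⟨K, hK0, hS, hD, hBK⟩ := ((eventually_gt_atTop (0 : ℝ)).and <|
    (eventually_all.2 fun l => eventually_ge_atTop (supplyMean ν l)).and <|
    (eventually_all.2 fun l => eventually_ge_atTop (loadMean ν l)).and <|
    eventually_ge_atTop B).exists
  exact ⟨K, hK0, hS, hD, fun x l => (hB x l).trans hBK⟩

variable {ν : Measure (State E)} [IsProbabilityMeasure ν] {T : ℕ} {K : ℝ}

/- The telescoped balance equations: the averages violate the constraints only through the initial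
and the final state, whose contributions are of order `1 / T`. -/
theorem isApproxFeasible_averageLaw (hν : FiniteMeans ν) (hT : T ≠ 0)
    (hS : ∀ l, supplyMean ν l ≤ K) (hD : ∀ l, loadMean ν l ≤ K)
    (hd : ∀ x l, M.demand l (π.price x l) ≤ K) :
    M.IsApproxFeasible (K / T) (supplyMean (averageLaw (M.stateLaw π ν) T))
      (loadMean (averageLaw (M.stateLaw π ν) T))
      (M.demandMean π (averageLaw (M.stateLaw π ν) T))
      (M.shippedMean π (averageLaw (M.stateLaw π ν) T)) := by
  have hprob := hπ.isProbabilityMeasure_stateLaw ν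
  have := isProbabilityMeasure_averageLaw (μ := M.stateLaw π ν) hT
  have hfin := hπ.finiteMeans_averageLaw hν hT
  refine ⟨shippedMean_nonneg _, hπ.shippedMean_le_supplyMean hfin, hπ.shippedMean_le_loadMean hfin,
    fun l => ?_, fun l => ?_, hπ.demandMean_mem⟩
  · rw [hπ.loadMean_averageLaw_sub_demandMean hν l, abs_div, Nat.abs_cast]
    gcongr
    exact abs_sub_le_of_nonneg_of_le (loadMean_nonneg _ l) (hD l) (loadMean_nonneg _ l)
      (hπ.loadMean_stateLaw_le (hD l) (hd · l) T)
  · rw [← sub_le_iff_le_add', hπ.supplyMean_averageLaw_sub_inflow hν hT l]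
    gcongr
    exact (sub_le_self _ (supplyMean_nonneg _ l)).trans (hS l)

theorem averageProfit_le (hIC : M.IsIC π) (hIR : M.IsIR π) (hν : FiniteMeans ν) (hT : T ≠ 0)
    (hK : 0 < K) (hKT : M.reduction * K ≤ T) (hS : ∀ l, supplyMean ν l ≤ K)
    (hD : ∀ l, loadMean ν l ≤ K) (hd : ∀ x l, M.demand l (π.price x l) ≤ K) :
    M.averageProfit π ν T ≤ M.FAValue +
      (((∑ l, |M.penalty l|) * (2 + M.reduction * K) * K / T : ℝ) : EReal) := by
  have hT0 : (0 : ℝ) < T := Nat.cast_pos.2 (Nat.pos_of_ne_zero hT)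
  have hprob := hπ.isProbabilityMeasure_stateLaw ν
  have := isProbabilityMeasure_averageLaw (μ := M.stateLaw π ν) hT
  have hfin := hπ.finiteMeans_averageLaw hν hT
  have hshipped := fun l => (hπ.shippedMean_le_loadMean hfin l).trans
    (hπ.loadMean_averageLaw_le hν hT (hD l) (hd · l))
  obtain ⟨g, hg, hle, hint⟩ := hπ.exists_integrable_profit_le_faValue_add hIC hIR hfin
    (div_pos hK hT0) (by rwa [← mul_div_assoc, div_le_one hT0])
    (hπ.isApproxFeasible_averageLaw hν hT hS hD hd) hshipped
  rw [mul_div_assoc]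
  exact (sum_extExpectation_div_le hT hg hle).trans hint

theorem longRunProfit_le_faValue (hIC : M.IsIC π) (hIR : M.IsIR π) (hν : FiniteMeans ν) :
    M.longRunProfit π ν ≤ M.FAValue := by
  obtain ⟨K, hK, hS, hD, hd⟩ := hπ.exists_pos_bound ν
  refine limsup_le_of_eventually_le_add_div
    (c := (∑ l, |M.penalty l|) * (2 + M.reduction * K) * K) ?_
  filter_upwards [eventually_ne_atTop 0,
    tendsto_natCast_atTop_atTop.eventually_ge_atTop (M.reduction * K)] with T hT hKT
  exact hπ.averageProfit_le hIC hIR hν hT hK hKT hS hD hd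

end IsPolicy

end Market

end Freight

theorem theorem1 {N : Type*} [DecidableEq N] {E : Finset (N × N)}
    (M : Freight.Market E) (π : Freight.Policy E) (hπ : M.IsPolicy π)
    (hIC : M.IsIC π) (hIR : M.IsIR π)
    (ν : MeasureTheory.Measure (Freight.State E)) [MeasureTheory.IsProbabilityMeasure ν]
    (hS : ∀ l, MeasureTheory.Integrable (fun x : Freight.State E => (x.1 l : ℝ)) ν)
    (hD : ∀ l, MeasureTheory.Integrable (fun x : Freight.State E => (x.2 l : ℝ)) ν) :
    M.longRunProfit π ν ≤ M.FAValue :=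
  hπ.longRunProfit_le_faValue hIC hIR ⟨hS, hD⟩
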